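/- Conventions. Let $G$ be a finite abelian group and $\mu_G(S)=|S|/|G|$ for $S\subset G$. For real $d\ge 1$, a \emph{Bourgain system of dimension $d$} is a family $\mathcal B=(B_\rho)_{\rho\in(0,2]}$ of subsets of $G$ such that: $B_{\rho'}\subset B_\rho$ if $\rho'\le\rho$; $0\in B_\rho$; $-B_\rho=B_\rho$; $B_\rho+B_{\rho'}\subset B_{\rho+\rho'}$ if $\rho+\rho'\le 1$; and for each $\rho\le 1$ there is $X\subset G$ with $|X|\le 2^d$ and $B_{2\rho}\subset\bigcup_{x\in X}(x+B_\rho)$. Put $\mu_G(\mathcal B):=\mu_G(B_1)$, and let $\beta$ be the normalized counting measure on $B_1$; similarly $\beta''$ for $\mathcal B''$, and so on. A Bourgain system $\mathcal B$ of dimension $d$ is \emph{regular (as a system of dimension $d$)} if $1-2^3d|\eta|\le \mu_G(B_1)/\mu_G(B_{1+\eta})\le 1+2^3d|\eta|$ for all real $\eta$ with $d|\eta|\le 2^{-3}$. A \emph{dilate} of $\mathcal B$ is a system $\lambda\mathcal B=(B_{\lambda\rho})_\rho$ with $\lambda\in(0,1]$; also $2\cdot\mathcal B:=(\{2x:x\in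 B_\rho\})_\rho$ and $\mathcal B\cap\mathcal B':=(B_\rho\cap B'_\rho)_\rho$. For $f,g,h:G\to\mathbb R$, $$\Lambda(f,g,h):=\frac1{|G|^2}\sum_{x,y\in G}f(x-y)g(x)h(x+y).$$ Lemma (Iteration lemma). Suppose that $\mathcal B$ is a regular Bourgain system of dimension $d$ in a finite abelian group $G$, that $A\subset G$ has $\alpha:=\|1_A*\beta\|_{L^\infty(\mu_G)}>0$, and that $A-A$ contains no elements of order $2$. Then at least one of the following holds. 1. (Lots of three-term progressions) $$\Lambda(1_A,1_A,1_A)\ge\frac{\alpha^3}{2^5}\left(\frac{\alpha^3}{2^{44}(1+d)^3}\right)^d\mu_G(\mathcal B)^2.$$ 2. (Density increment I) There is a dilate $\mathcal B''$ of $\mathcal B$, regular as a system of dimension $d$, with $$\mu_G(\mathcal B'')\ge\left(\frac{\alpha^2}{2^{25}(1+d)^2}\right)^d\mu_G(\mathcal B)\quad\text{and}\quad \|1_A*\beta''\|_{L^\infty(\mu_G)}\ge\alpha(1+2^{-12}).$$ 3. (Density increment II) There is a dilate $\mathcal B'''$ of $2\cdot\mathcal B$, regular as a system of dimension $d$, with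 $$\mu_G(\mathcal B''')\ge\frac{\alpha}{2^2}\left(\frac{\alpha^3}{2^{36}(1+d)^3}\right)^d\mu_G(\mathcal B)\quad\text{and}\quad \|1_A*\beta'''\|_{L^\infty(\mu_G)}\ge\alpha(1+2^{-8}).$$ 4. (Density increment III) There are a Bourgain system $\widetilde{\mathcal B}''''$ of some dimension $\widetilde d\le 2^{13}\alpha^{-3}$ and a dilate $\mathcal B'''$ of $2\cdot\mathcal B$ such that their intersection $\mathcal B'''':=\widetilde{\mathcal B}''''\cap\mathcal B'''$ is a Bourgain system of dimension $2(\widetilde d+d)$, is regular as a system of dimension $D$ for every $D$ for which it is a Bourgain system of dimension $D$, and satisfies $$\mu_G(\mathcal B'''')\ge\frac{\alpha}{2^2}\left(\frac{\alpha^3}{2^{22}(1+d)}\right)^{2^{13}\alpha^{-3}}\left(\frac{\alpha^5}{2^{48}(1+d)^3}\right)^d\mu_G(\mathcal B)\quad\text{and}\quad \|1_A*\beta''''\|_{L^\infty(\mu_G)}\ge\alpha(1+2^{-8}).$$ -/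

import Mathlib

open scoped Pointwise

namespace BourgainRoth

variable {G : Type*} [AddCommGroup G] [Fintype G] [DecidableEq G]

/-- The Haar probability measure `μ_G(S) = |S| / |G|` of a subset `S` of the finite group `G`. -/
noncomputable def haar (S : Finset G) : ℝ := (S.card : ℝ) / (Fintype.card G : ℝ)

/-- The family `B` is a Bourgain system of dimension `d`. The index `ρ` runs over `(0, 2]`;
the values of `B` outside `(0, 2]` play no role. -/
structure IsBourgainSystem (B : ℝ → Finset G) (d : ℝ) : Prop where
  one_le_dim : 1 ≤ d
  nesting : ∀ ρ' ρ : ℝ, 0 < ρ' → ρ' ≤ ρ → ρ ≤ 2 → B ρ' ⊆ B ρ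
  zero_mem : ∀ ρ : ℝ, 0 < ρ → ρ ≤ 2 → (0 : G) ∈ B ρ
  symmetry : ∀ ρ : ℝ, 0 < ρ → ρ ≤ 2 → ∀ x ∈ B ρ, -x ∈ B ρ
  addition : ∀ ρ ρ' : ℝ, 0 < ρ → 0 < ρ' → ρ + ρ' ≤ 1 → B ρ + B ρ' ⊆ B (ρ + ρ')
  doubling : ∀ ρ : ℝ, 0 < ρ → ρ ≤ 1 →
    ∃ X : Finset G, (X.card : ℝ) ≤ (2 : ℝ) ^ d ∧ B (2 * ρ) ⊆ X.biUnion (fun x => x +ᵥ B ρ)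

/-- The density `μ_G(B_1)` of a Bourgain system. -/
noncomputable def density (B : ℝ → Finset G) : ℝ := haar (B 1)

/-- `B` is a regular Bourgain system of dimension `d`. (Since `d ≥ 1`, only indices `1 + η` in
`[7/8, 9/8]` occur.) -/
structure IsRegular (B : ℝ → Finset G) (d : ℝ) : Prop where
  isBourgainSystem : IsBourgainSystem B d
  regular : ∀ η : ℝ, d * |η| ≤ 1 / 2 ^ 3 →
    1 - 2 ^ 3 * d * |η| ≤ haar (B 1) / haar (B (1 + η)) ∧
      haar (B 1) / haar (B (1 + η)) ≤ 1 + 2 ^ 3 * d * |η|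

/-- The dilate `lB = (B_{lρ})_ρ`, used for `0 < l ≤ 1`. -/
def dilate (l : ℝ) (B : ℝ → Finset G) : ℝ → Finset G := fun ρ => B (l * ρ)

/-- The system `({2x : x ∈ B_ρ})_ρ`. -/
def double (B : ℝ → Finset G) : ℝ → Finset G := fun ρ => (B ρ).image (fun x => 2 • x)

/-- The intersection `(B_ρ ∩ B'_ρ)_ρ` of two systems. -/
def inter (B B' : ℝ → Finset G) : ℝ → Finset G := fun ρ => B ρ ∩ B' ρ

/-- The indicator function `1_A`. -/
def ind (A : Finset G) : G → ℝ := fun x => if x ∈ A then 1 else 0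

/-- The convolution of `f` with the normalized counting measure on `S`. -/
noncomputable def conv (f : G → ℝ) (S : Finset G) : G → ℝ :=
  fun x => (∑ y ∈ S, f (x - y)) / (S.card : ℝ)

/-- The norm of `L^∞(μ_G)`: every point of `G` has positive mass, so this is the supremum. -/
noncomputable def supNorm (f : G → ℝ) : ℝ := ⨆ x : G, |f x|

/-- `‖1_A ∗ β‖_{L^∞(μ_G)}`, where `β` is the normalized counting measure on `B_1`. -/
noncomputable def maxDensity (A : Finset G) (B : ℝ → Finset G) : ℝ :=
  supNorm (conv (ind A) (B 1))

/-- The trilinear form `Λ(f, g, h) = ∫∫ f(x - y) g(x) h(x + y) dμ_G(x) dμ_G(y)`. -/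
noncomputable def Lam (f g h : G → ℝ) : ℝ :=
  (∑ x : G, ∑ y : G, f (x - y) * g x * h (x + y)) / (Fintype.card G : ℝ) ^ 2

end BourgainRoth

open scoped Pointwise

set_option linter.unusedSectionVars false

namespace BourgainRoth

/-! Progressions are counted by their middle term: up to normalisation `Lam` is the sum over `x ∈ A`
of `1_A * 1_A` at `2x`. Two regular dilates are chosen, `P = B l₁` with `l₁` about `α / (1 + d)`,
and `Q = B l₂` smaller by a further factor of that order. Unless one of them already gives increment
I, averaging over a translate of `B 1` finds a translate of `A` with density at least `0.96 α` on
both (`exists_dense_at_two_scales`); `A` is replaced by it.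

Let `f` be the deviation of `A ∩ P` from its density `a` on `P`. For `x ∈ A ∩ Q` regularity makes
`P` almost invariant under `2x`, so `1_{A ∩ P} * 1_{A ∩ P}` at `2x` is at least about `a² |P| + (f *
f)(2x)`. Summed over `x`, either this yields many progressions, or `f * f` is very negative on
average over the doubled points of `A ∩ Q` (`many_progressions_or_correlation`).

In the second case a fixed share of the Fourier energy of `f` sits on characters biased on the
doubled `A ∩ Q` (`energy_on_biased_characters`). A maximal subfamily `Γ`, almost orthogonal on `Q`
after composition with doubling, has `O(α⁻³)` members by Bessel
(`card_mul_le_of_almost_orthogonal`), and every biased character correlates on `Q` with a member of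
`Γ`. Regularity of `Q` upgrades correlation to closeness, so all biased characters are near `1` on
the intersection `C` of a Bohr set of `Γ` with a small dilate of the doubled system
(`exists_bohr_set_annihilating`). Smoothing by `C` keeps that energy, and an `L²` argument makes `A`
denser on a translate of `C` (`exists_conv_ge_of_energy`). This is increment III; increment II never
has to be invoked. The condition on order `2` makes doubling injective on `A`, which keeps `C`
large. -/

/-! ### Regular scales of a monotone function, by Vitali covering. -/

lemma sum_increments_le {ι : Type*} {w : ℝ → ℝ} {p q : ℝ} (hw : MonotoneOn w (Set.Icc p q))
    (a b : ι → ℝ) (s : Finset ι) (hpq : p ≤ q) (ha : ∀ i ∈ s, p ≤ a i) (hab : ∀ i ∈ s, a i ≤ b i)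
    (hb : ∀ i ∈ s, b i ≤ q)
    (hd : (s : Set ι).PairwiseDisjoint fun i => Set.Icc (a i) (b i)) :
    ∑ i ∈ s, (w (b i) - w (a i)) ≤ w q - w p := by
  classical
  -- The interval with the largest right endpoint is removed. By disjointness the others end before
  -- its left endpoint, so the induction hypothesis applies with `q` replaced by `a i`.
  induction s using Finset.induction_on_max_value b generalizing q with
  | empty => simpa using hw (Set.left_mem_Icc.2 hpq) (Set.right_mem_Icc.2 hpq) hpq
  | insert i s his hmax ih =>
    rw [Finset.sum_insert his]
    have hai := ha i (Finset.mem_insert_self _ _)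
    have habi := hab i (Finset.mem_insert_self _ _)
    have hbi := hb i (Finset.mem_insert_self _ _)
    have key : ∑ j ∈ s, (w (b j) - w (a j)) ≤ w (a i) - w p := by
      refine ih (hw.mono (Set.Icc_subset_Icc le_rfl (habi.trans hbi))) hai
        (fun j hj => ha j (Finset.mem_insert_of_mem hj))
        (fun j hj => hab j (Finset.mem_insert_of_mem hj)) (fun j hj => ?_)
        (hd.subset (by simp))
      by_contra! hlt
      have hne : j ≠ i := fun h => his (h ▸ hj)
      have := hd (by simp [hj] : j ∈ ((insert i s : Finset ι) : Set ι))
        (by simp : i ∈ ((insert i s : Finset ι) : Set ι)) hne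
      exact Set.disjoint_left.1 this
        (Set.right_mem_Icc.2 (hab j (Finset.mem_insert_of_mem hj))) ⟨hlt.le, hmax j hj⟩
    have h1 : w (b i) ≤ w q := hw ⟨hai.trans habi, hbi⟩ (Set.right_mem_Icc.2 hpq) hbi
    linarith

/-- A covering bound: if every point of `[s₀, s₁]` lies in an interval over which the monotone
function `w` grows at rate at least `K`, then `w` grows a lot in total. -/
lemma length_le_of_steep {w : ℝ → ℝ} {p q s₀ s₁ K τ : ℝ} (hpq : p ≤ q)
    (hw : MonotoneOn w (Set.Icc p q)) (hK : 0 < K) (hτ : 3 < τ)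
    (h : ∀ s ∈ Set.Icc s₀ s₁, ∃ a b, p ≤ a ∧ a < b ∧ b ≤ q ∧ s ∈ Set.Icc a b ∧
      K * (b - a) ≤ w b - w a) :
    s₁ - s₀ ≤ τ * ((w q - w p) / K) := by
  choose! a b hpa hab hbq hmem hinc using h
  have hball : ∀ s, Metric.closedBall ((a s + b s) / 2) ((b s - a s) / 2) = Set.Icc (a s) (b s) := by
    intro s
    rw [Real.closedBall_eq_Icc]
    congr 1 <;> ring
  -- The disjoint subfamily has total length at most (growth of `w`) / `K`, and its `τ`-fold
  -- enlargements still cover.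
  obtain ⟨u, hut, hud, hcov⟩ := Vitali.exists_disjoint_subfamily_covering_enlargement_closedBall
    (Set.Icc s₀ s₁) (fun s => (a s + b s) / 2) (fun s => (b s - a s) / 2) (q - p)
    (fun s hs => by linarith [hpa s hs, hab s hs, hbq s hs]) τ hτ
  simp only [hball] at hud hcov
  have hc : u.Countable := hud.countable_of_nonempty_interior fun i hi => by
    rw [interior_Icc]; exact Set.nonempty_Ioo.2 (hab i (hut hi))
  have hsub : Set.Icc s₀ s₁ ⊆ ⋃ i ∈ u,
      Metric.closedBall ((a i + b i) / 2) (τ * ((b i - a i) / 2)) := by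
    intro s hs
    obtain ⟨i, hi, hsi⟩ := hcov s hs
    exact Set.mem_biUnion hi (hsi (hmem s hs))
  have hT : 0 ≤ (w q - w p) / K :=
    div_nonneg (sub_nonneg.2 (hw (Set.left_mem_Icc.2 hpq) (Set.right_mem_Icc.2 hpq) hpq)) hK.le
  have hvol : MeasureTheory.volume (Set.Icc s₀ s₁) ≤ ENNReal.ofReal (τ * ((w q - w p) / K)) := by
    calc MeasureTheory.volume (Set.Icc s₀ s₁)
        ≤ MeasureTheory.volume (⋃ i ∈ u,
          Metric.closedBall ((a i + b i) / 2) (τ * ((b i - a i) / 2))) :=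
          MeasureTheory.measure_mono hsub
      _ ≤ ∑' i : u, MeasureTheory.volume
          (Metric.closedBall ((a i + b i) / 2) (τ * ((b i - a i) / 2))) :=
          MeasureTheory.measure_biUnion_le _ hc _
      _ ≤ ENNReal.ofReal (τ * ((w q - w p) / K)) := by
          rw [ENNReal.tsum_eq_iSup_sum]
          refine iSup_le fun s => ?_
          have hpos : ∀ i ∈ s, 0 ≤ τ * (b (i : u) - a (i : u)) := fun i _ =>
            mul_nonneg (by linarith) (sub_nonneg.2 (hab _ (hut i.2)).le)
          have e : ∀ i : u, MeasureTheory.volume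
              (Metric.closedBall ((a i + b i) / 2) (τ * ((b i - a i) / 2)))
              = ENNReal.ofReal (τ * (b i - a i)) := by
            intro i
            rw [Real.volume_closedBall]; congr 1; ring
          simp only [e]
          rw [← ENNReal.ofReal_sum_of_nonneg hpos]
          refine ENNReal.ofReal_le_ofReal ?_
          rw [← Finset.mul_sum]
          refine mul_le_mul_of_nonneg_left ?_ (by linarith)
          rw [le_div_iff₀ hK, mul_comm, Finset.mul_sum]
          have hle : ∀ i ∈ s, K * (b (i : ℝ) - a (i : ℝ)) ≤ w (b (i : ℝ)) - w (a (i : ℝ)) :=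
            fun (i : u) _ => hinc i (hut i.2)
          refine (Finset.sum_le_sum hle).trans ?_
          refine sum_increments_le hw (fun i : u => a i) (fun i : u => b i) s hpq
            (fun i _ => hpa i (hut i.2)) (fun i _ => (hab i (hut i.2)).le)
            (fun i _ => hbq i (hut i.2)) ?_
          intro i _ j _ hij
          exact hud i.2 j.2 fun h => hij (Subtype.ext h)
  rw [Real.volume_Icc] at hvol
  exact (ENNReal.ofReal_le_ofReal_iff (mul_nonneg (by linarith) hT)).1 hvol

/-- Bernoulli's inequality `2 ^ t ≤ 1 + t` on `[0, 1]`. -/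
lemma le_logb_sub_logb {x y t : ℝ} (hx : 0 < x) (hy : 0 < y) (ht0 : 0 ≤ t) (ht1 : t ≤ 1)
    (h : 1 + t ≤ x / y) : t ≤ Real.logb 2 x - Real.logb 2 y := by
  rw [← Real.logb_div hx.ne' hy.ne', Real.le_logb_iff_rpow_le (by norm_num) (by positivity)]
  have := rpow_one_add_le_one_add_mul_self (s := 1) (by norm_num) ht0 ht1
  norm_num at this
  linarith

/-- A positive monotone function which grows by a factor of at most `2 ^ D` on `[1/2, 1]` has a
point around which it varies in a controlled way. -/
lemma exists_regular_scale {v : ℝ → ℝ} {D : ℝ} (hD : 1 ≤ D)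
    (hv : MonotoneOn v (Set.Icc (1 / 2) 1)) (hpos : ∀ t ∈ Set.Icc (1 / 2 : ℝ) 1, 0 < v t)
    (hgrowth : v 1 ≤ 2 ^ D * v (1 / 2)) :
    ∃ l : ℝ, 1 / 2 ≤ l ∧ l ≤ 1 ∧ ∀ η : ℝ, D * |η| ≤ 1 / 2 ^ 3 →
      1 - 2 ^ 3 * D * |η| ≤ v l / v (l * (1 + η)) ∧
        v l / v (l * (1 + η)) ≤ 1 + 2 ^ 3 * D * |η| := by
  by_contra! hcon
  have hD0 : 0 < D := by linarith
  set w : ℝ → ℝ := fun s => Real.logb 2 (v (Real.exp s)) with hwdef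
  have hexp : ∀ s ∈ Set.Icc (Real.log (1 / 2)) 0, Real.exp s ∈ Set.Icc (1 / 2 : ℝ) 1 := by
    intro s hs
    refine ⟨(Real.log_le_iff_le_exp (by norm_num)).1 hs.1, Real.exp_le_one_iff.2 hs.2⟩
  have hw : MonotoneOn w (Set.Icc (Real.log (1 / 2)) 0) := by
    intro s hs t ht hst
    exact Real.logb_le_logb_of_le (by norm_num) (hpos _ (hexp s hs))
      (hv (hexp s hs) (hexp t ht) (Real.exp_le_exp.2 hst))
  -- The range `[4/7, 8/9]` keeps `l * (1 + η)` inside `[1/2, 1]` for `|η| ≤ 1/8`. A failure of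
  -- regularity gives binary-log growth at least `8 D |η|` over a logarithmic length of at most `8/7
  -- |η|`, hence rate `7 D`.
  have hsteep : ∀ s ∈ Set.Icc (Real.log (4 / 7)) (Real.log (8 / 9)),
      ∃ a b, Real.log (1 / 2) ≤ a ∧ a < b ∧ b ≤ 0 ∧ s ∈ Set.Icc a b ∧
        7 * D * (b - a) ≤ w b - w a := by
    intro s hs
    obtain ⟨l, hl0, rfl⟩ : ∃ l : ℝ, 0 < l ∧ Real.log l = s :=
      ⟨Real.exp s, Real.exp_pos _, Real.log_exp _⟩
    have hl1 : 4 / 7 ≤ l := (Real.log_le_log_iff (by norm_num) hl0).1 hs.1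
    have hl2 : l ≤ 8 / 9 := (Real.log_le_log_iff hl0 (by norm_num)).1 hs.2
    obtain ⟨η, hη, hbad⟩ := hcon l (by linarith) (by linarith)
    have hη8 : |η| ≤ 1 / 8 := by nlinarith [abs_nonneg η]
    obtain ⟨hη1, hη2⟩ := abs_le.1 hη8
    have hlη0 : 0 < l * (1 + η) := mul_pos hl0 (by linarith)
    have hmem : l ∈ Set.Icc (1 / 2 : ℝ) 1 := ⟨by linarith, by linarith⟩
    have hmem' : l * (1 + η) ∈ Set.Icc (1 / 2 : ℝ) 1 := ⟨by nlinarith, by nlinarith⟩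
    have hx := hpos _ hmem
    have hy := hpos _ hmem'
    have hlog : Real.log (l * (1 + η)) = Real.log l + Real.log (1 + η) :=
      Real.log_mul hl0.ne' (by linarith)
    have e1 : w (Real.log l) = Real.logb 2 (v l) := by simp only [hwdef, Real.exp_log hl0]
    have e2 : w (Real.log (l * (1 + η))) = Real.logb 2 (v (l * (1 + η))) := by
      simp only [hwdef, Real.exp_log hlη0]
    have ht0 : 0 ≤ 2 ^ 3 * D * |η| := by positivity
    have ht1 : 2 ^ 3 * D * |η| ≤ 1 := by linarith
    by_cases hlow : 1 - 2 ^ 3 * D * |η| ≤ v l / v (l * (1 + η))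
    · have hup := hbad hlow
      have hneg : η < 0 := by
        by_contra! hge
        have : v l / v (l * (1 + η)) ≤ 1 :=
          (div_le_one hy).2 (hv hmem hmem' (by nlinarith))
        linarith
      have hg := le_logb_sub_logb hx hy ht0 ht1 hup.le
      have hlogneg : Real.log (1 + η) < 0 := Real.log_neg (by linarith) (by linarith)
      have hlen : -Real.log (1 + η) ≤ 8 / 7 * |η| := by
        have h1 := Real.one_sub_inv_le_log_of_pos (show 0 < 1 + η by linarith)
        have h2 : (1 + η)⁻¹ ≤ 1 + 8 / 7 * |η| := by
          rw [inv_le_iff_one_le_mul₀ (by linarith), abs_of_neg hneg]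
          nlinarith
        linarith
      refine ⟨Real.log (l * (1 + η)), Real.log l, ?_, by linarith, ?_, ⟨by linarith, le_rfl⟩, ?_⟩
      · exact Real.log_le_log (by norm_num) hmem'.1
      · exact Real.log_nonpos hl0.le hmem.2
      · rw [e1, e2]
        refine le_trans ?_ hg
        have : Real.log l - Real.log (l * (1 + η)) ≤ 8 / 7 * |η| := by linarith
        nlinarith
    · push Not at hlow
      have hgt : 0 < η := by
        by_contra! hle
        have : 1 ≤ v l / v (l * (1 + η)) :=
          (one_le_div hy).2 (hv hmem' hmem (by nlinarith))
        linarith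
      have hr : 0 < v l / v (l * (1 + η)) := div_pos hx hy
      have hup : 1 + 2 ^ 3 * D * |η| ≤ v (l * (1 + η)) / v l := by
        rw [← inv_div, le_inv_comm₀ (by linarith) hr, ]
        refine hlow.le.trans ?_
        rw [le_inv_comm₀ (by linarith) (by linarith), inv_eq_one_div,
          le_div_iff₀ (by linarith)]
        nlinarith
      have hg := le_logb_sub_logb hy hx ht0 ht1 hup
      have hlogpos : 0 < Real.log (1 + η) := Real.log_pos (by linarith)
      have hlen : Real.log (1 + η) ≤ |η| := by
        rw [abs_of_pos hgt]
        have := Real.log_le_sub_one_of_pos (show 0 < 1 + η by linarith)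
        linarith
      refine ⟨Real.log l, Real.log (l * (1 + η)), ?_, by linarith, ?_, ⟨le_rfl, by linarith⟩, ?_⟩
      · exact Real.log_le_log (by norm_num) hmem.1
      · exact Real.log_nonpos hlη0.le hmem'.2
      · rw [e1, e2]
        refine le_trans ?_ hg
        have : Real.log (l * (1 + η)) - Real.log l ≤ |η| := by linarith
        nlinarith [abs_nonneg η]
  -- Total growth at most `D` bounds the covered length by `3.01 / 7 = 0.43`, just below `log (14/9)
  -- ≈ 0.442`.
  have hfin := length_le_of_steep (τ := 3.01) (Real.log_nonpos (by norm_num) (by norm_num)) hw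
    (by positivity : (0 : ℝ) < 7 * D) (by norm_num) hsteep
  have hw0 : w 0 - w (Real.log (1 / 2)) ≤ D := by
    have h1 := hpos 1 (by norm_num)
    have h2 := hpos (1 / 2) (by norm_num)
    simp only [hwdef, Real.exp_zero, Real.exp_log (show (0 : ℝ) < 1 / 2 by norm_num)]
    rw [← Real.logb_div h1.ne' h2.ne', Real.logb_le_iff_le_rpow (by norm_num) (div_pos h1 h2),
      div_le_iff₀ h2]
    exact hgrowth
  have h43 : Real.log (8 / 9) - Real.log (4 / 7) ≤ 0.43 := by
    refine hfin.trans ?_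
    have : (w 0 - w (Real.log (1 / 2))) / (7 * D) ≤ 1 / 7 := by
      rw [div_le_iff₀ (by positivity)]; linarith
    linarith
  rw [← Real.log_div (by norm_num) (by norm_num), Real.log_le_iff_le_exp (by norm_num)] at h43
  have := Real.exp_bound' (x := 0.43) (by norm_num) (by norm_num) (n := 5) (by norm_num)
  norm_num [Finset.sum_range_succ, Nat.factorial] at this h43
  linarith

lemma haar_div_haar {G : Type*} [AddCommGroup G] [Fintype G] (S T : Finset G) : haar S / haar T = (S.card : ℝ) / T.card := by
  have : (Fintype.card G : ℝ) ≠ 0 := Nat.cast_ne_zero.2 Fintype.card_ne_zero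
  rw [haar, haar, div_div_div_cancel_right₀ this]

/-! ### Bourgain systems: sizes, operations and regular dilates. -/

section Systems
variable {G : Type*} [AddCommGroup G] [DecidableEq G] {B B' : ℝ → Finset G} {d d' : ℝ}

/-- One representative is kept per nonempty fibre of the labelling `c`. -/
lemma exists_translates_cover {β : Type*} [DecidableEq β] (S U : Finset G) (T : Finset β)
    (c : G → β) (hc : ∀ x ∈ S, c x ∈ T) (h : ∀ x ∈ S, ∀ y ∈ S, c x = c y → x - y ∈ U) :
    ∃ X : Finset G, X.card ≤ T.card ∧ S ⊆ X.biUnion (fun x => x +ᵥ U) := by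
  have hrep : ∀ b ∈ S.image c, ∃ x ∈ S, c x = b := fun b hb => Finset.mem_image.1 hb
  choose! rep hrepS hrepc using hrep
  refine ⟨(S.image c).image rep, Finset.card_image_le.trans (Finset.card_le_card
    (Finset.image_subset_iff.2 hc)), fun x hx => ?_⟩
  have hcx := Finset.mem_image_of_mem c hx
  refine Finset.mem_biUnion.2 ⟨rep (c x), Finset.mem_image_of_mem _ hcx, ?_⟩
  rw [Finset.mem_vadd_finset]
  exact ⟨x - rep (c x), h _ hx _ (hrepS _ hcx) (hrepc _ hcx).symm, by simp⟩

lemma card_le_of_cover {S U X : Finset G} (h : S ⊆ X.biUnion (fun x => x +ᵥ U)) :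
    S.card ≤ X.card * U.card :=
  (Finset.card_le_card h).trans (Finset.card_biUnion_le_card_mul _ _ _ fun x _ => by simp)

namespace IsBourgainSystem

lemma card_pos (hB : IsBourgainSystem B d) {ρ : ℝ} (h0 : 0 < ρ) (h2 : ρ ≤ 2) :
    0 < ((B ρ).card : ℝ) :=
  Nat.cast_pos.2 (Finset.card_pos.2 ⟨0, hB.zero_mem ρ h0 h2⟩)

lemma card_two_mul_le (hB : IsBourgainSystem B d) {ρ : ℝ} (h0 : 0 < ρ) (h1 : ρ ≤ 1) :
    ((B (2 * ρ)).card : ℝ) ≤ 2 ^ d * (B ρ).card := by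
  obtain ⟨X, hX, hcov⟩ := hB.doubling ρ h0 h1
  have : ((B (2 * ρ)).card : ℝ) ≤ X.card * (B ρ).card := by exact_mod_cast card_le_of_cover hcov
  exact this.trans (by gcongr)

lemma card_le_pow_mul (hB : IsBourgainSystem B d) {ρ : ℝ} (h0 : 0 < ρ) (h1 : ρ ≤ 1) (n : ℕ) :
    ((1 / 2) ^ n) ^ d * ((B ρ).card : ℝ) ≤ (B ((1 / 2) ^ n * ρ)).card := by
  induction n with
  | zero => simp
  | succ n ih =>
    have hp : (0 : ℝ) < (1 / 2) ^ n := by positivity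
    have hp1 : (1 / 2 : ℝ) ^ n ≤ 1 := pow_le_one₀ (by norm_num) (by norm_num)
    have h := hB.card_two_mul_le (ρ := (1 / 2) ^ (n + 1) * ρ) (by positivity)
      (by rw [pow_succ]; nlinarith)
    have e : 2 * ((1 / 2 : ℝ) ^ (n + 1) * ρ) = (1 / 2) ^ n * ρ := by ring
    rw [e] at h
    rw [pow_succ, Real.mul_rpow hp.le (by norm_num), ← pow_succ]
    have h2 : (1 / 2 : ℝ) ^ d * 2 ^ d = 1 := by
      rw [← Real.mul_rpow (by norm_num) (by norm_num)]; norm_num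
    have h3 : (0 : ℝ) < (1 / 2) ^ d := by positivity
    calc ((1 / 2 : ℝ) ^ n) ^ d * (1 / 2) ^ d * ((B ρ).card : ℝ)
        = (1 / 2) ^ d * (((1 / 2 : ℝ) ^ n) ^ d * ((B ρ).card : ℝ)) := by ring
      _ ≤ (1 / 2) ^ d * (2 ^ d * (B ((1 / 2) ^ (n + 1) * ρ)).card) := by
          exact mul_le_mul_of_nonneg_left (ih.trans h) h3.le
      _ = _ := by rw [← mul_assoc, h2, one_mul]

/-- Each halving costs `2 ^ d`; rounding `l` down to a power of `1/2` is what turns `l` into `l /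
2`. -/
lemma card_mul_le (hB : IsBourgainSystem B d) {ρ l : ℝ} (h0 : 0 < ρ) (h1 : ρ ≤ 1)
    (hl0 : 0 < l) (hl1 : l ≤ 1) :
    (l / 2) ^ d * ((B ρ).card : ℝ) ≤ (B (l * ρ)).card := by
  obtain ⟨n, hn, hn'⟩ := exists_nat_pow_near_of_lt_one hl0 hl1 (y := (1 / 2 : ℝ))
    (by norm_num) (by norm_num)
  have hd := hB.one_le_dim
  calc (l / 2) ^ d * ((B ρ).card : ℝ) ≤ ((1 / 2) ^ (n + 1)) ^ d * ((B ρ).card : ℝ) := by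
        gcongr
        rw [pow_succ]; linarith
    _ ≤ (B ((1 / 2) ^ (n + 1) * ρ)).card := hB.card_le_pow_mul h0 h1 _
    _ ≤ _ := by
        refine Nat.cast_le.2 (Finset.card_le_card (hB.nesting _ _ (by positivity) ?_ ?_))
        · gcongr
        · nlinarith

lemma sub_mem (hB : IsBourgainSystem B d) {ρ ρ' : ℝ} (h0 : 0 < ρ) (h0' : 0 < ρ')
    (h1 : ρ + ρ' ≤ 1) {x y : G} (hx : x ∈ B ρ) (hy : y ∈ B ρ') : x - y ∈ B (ρ + ρ') := by
  rw [sub_eq_add_neg]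
  exact hB.addition ρ ρ' h0 h0' h1 (Finset.add_mem_add hx (hB.symmetry _ h0' (by linarith) _ hy))

lemma add_mem (hB : IsBourgainSystem B d) {ρ ρ' : ℝ} (h0 : 0 < ρ) (h0' : 0 < ρ')
    (h1 : ρ + ρ' ≤ 1) {x y : G} (hx : x ∈ B ρ) (hy : y ∈ B ρ') : x + y ∈ B (ρ + ρ') :=
  hB.addition ρ ρ' h0 h0' h1 (Finset.add_mem_add hx hy)

lemma dilate (hB : IsBourgainSystem B d) {l : ℝ} (hl0 : 0 < l) (hl1 : l ≤ 1) :
    IsBourgainSystem (dilate l B) d where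
  one_le_dim := hB.one_le_dim
  nesting ρ' ρ h0 h1 h2 := hB.nesting _ _ (by positivity) (by gcongr) (by nlinarith)
  zero_mem ρ h0 h2 := hB.zero_mem _ (by positivity) (by nlinarith)
  symmetry ρ h0 h2 := hB.symmetry _ (by positivity) (by nlinarith)
  addition ρ ρ' h0 h0' h1 := by
    have := hB.addition (l * ρ) (l * ρ') (by positivity) (by positivity) (by nlinarith)
    simpa only [BourgainRoth.dilate, mul_add] using this
  doubling ρ h0 h1 := by
    obtain ⟨X, hX, h⟩ := hB.doubling (l * ρ) (by positivity) (by nlinarith)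
    refine ⟨X, hX, ?_⟩
    simpa only [BourgainRoth.dilate, mul_left_comm] using h

lemma double (hB : IsBourgainSystem B d) : IsBourgainSystem (double B) d where
  one_le_dim := hB.one_le_dim
  nesting ρ' ρ h0 h1 h2 := Finset.image_subset_image (hB.nesting _ _ h0 h1 h2)
  zero_mem ρ h0 h2 := Finset.mem_image.2 ⟨0, hB.zero_mem ρ h0 h2, smul_zero _⟩
  symmetry ρ h0 h2 x hx := by
    obtain ⟨y, hy, rfl⟩ := Finset.mem_image.1 hx
    exact Finset.mem_image.2 ⟨-y, hB.symmetry ρ h0 h2 y hy, smul_neg _ _⟩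
  addition ρ ρ' h0 h0' h1 := by
    intro z hz
    obtain ⟨x, hx, y, hy, rfl⟩ := Finset.mem_add.1 hz
    obtain ⟨u, hu, rfl⟩ := Finset.mem_image.1 hx
    obtain ⟨v, hv, rfl⟩ := Finset.mem_image.1 hy
    exact Finset.mem_image.2 ⟨u + v, hB.add_mem h0 h0' h1 hu hv, smul_add _ _ _⟩
  doubling ρ h0 h1 := by
    obtain ⟨X, hX, h⟩ := hB.doubling ρ h0 h1
    refine ⟨X.image (fun x => 2 • x), le_trans (by exact_mod_cast Finset.card_image_le) hX, ?_⟩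
    intro z hz
    obtain ⟨y, hy, rfl⟩ := Finset.mem_image.1 hz
    obtain ⟨x, hx, hyx⟩ := Finset.mem_biUnion.1 (h hy)
    obtain ⟨b, hb, rfl⟩ := Finset.mem_vadd_finset.1 hyx
    refine Finset.mem_biUnion.2 ⟨2 • x, Finset.mem_image_of_mem _ hx, ?_⟩
    exact Finset.mem_vadd_finset.2 ⟨2 • b, Finset.mem_image_of_mem _ hb, by simp [smul_add]⟩

/-- A doubled ball is covered by `4 ^ d` fibres of a labelling, each of which has all its
differences in the original ball. -/
lemma exists_labelling (hB : IsBourgainSystem B d) {ρ : ℝ} (h0 : 0 < ρ) (h1 : ρ ≤ 1) :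
    ∃ (T : Finset (G × G)) (c : G → G × G), (T.card : ℝ) ≤ 2 ^ (2 * d) ∧
      (∀ x ∈ B (2 * ρ), c x ∈ T) ∧
      ∀ x ∈ B (2 * ρ), ∀ y ∈ B (2 * ρ), c x = c y → x - y ∈ B ρ := by
  obtain ⟨X, hX, h⟩ := hB.doubling ρ h0 h1
  -- Covering twice reaches radius `ρ / 2`, so points sharing both centres differ by an element of
  -- `B ρ`.
  obtain ⟨Y, hY, h'⟩ := hB.doubling (ρ / 2) (by linarith) (by linarith)
  have key : ∀ z ∈ B (2 * ρ), ∃ p : G × G, p ∈ X ×ˢ Y ∧ z - p.1 - p.2 ∈ B (ρ / 2) := by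
    intro z hz
    obtain ⟨x, hx, hzx⟩ := Finset.mem_biUnion.1 (h hz)
    obtain ⟨b, hb, rfl⟩ := Finset.mem_vadd_finset.1 hzx
    rw [show ρ = 2 * (ρ / 2) by ring] at hb
    obtain ⟨y, hy, hby⟩ := Finset.mem_biUnion.1 (h' hb)
    obtain ⟨b', hb', rfl⟩ := Finset.mem_vadd_finset.1 hby
    exact ⟨(x, y), Finset.mem_product.2 ⟨hx, hy⟩, by simpa using hb'⟩
  choose! c hcT hc using key
  refine ⟨X ×ˢ Y, c, ?_, hcT, fun x hx y hy hxy => ?_⟩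
  · rw [Finset.card_product, Nat.cast_mul, two_mul, Real.rpow_add (by norm_num)]
    gcongr
  · have := hB.sub_mem (by linarith) (by linarith) (by linarith) (hc x hx) (hc y hy)
    rw [hxy, add_halves] at this
    simpa using this

/-- The coverings of the two systems have unrelated centres, so pairs of labels are used with
representatives inside the intersection. Each labelling costs twice the dimension. -/
lemma inter (hB : IsBourgainSystem B d) (hB' : IsBourgainSystem B' d') :
    IsBourgainSystem (inter B B') (2 * (d + d')) where
  one_le_dim := by linarith [hB.one_le_dim, hB'.one_le_dim]
  nesting ρ' ρ h0 h1 h2 :=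
    Finset.inter_subset_inter (hB.nesting _ _ h0 h1 h2) (hB'.nesting _ _ h0 h1 h2)
  zero_mem ρ h0 h2 := Finset.mem_inter.2 ⟨hB.zero_mem ρ h0 h2, hB'.zero_mem ρ h0 h2⟩
  symmetry ρ h0 h2 x hx := by
    obtain ⟨hx, hx'⟩ := Finset.mem_inter.1 hx
    exact Finset.mem_inter.2 ⟨hB.symmetry ρ h0 h2 x hx, hB'.symmetry ρ h0 h2 x hx'⟩
  addition ρ ρ' h0 h0' h1 := by
    intro z hz
    obtain ⟨x, hx, y, hy, rfl⟩ := Finset.mem_add.1 hz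
    obtain ⟨hx, hx'⟩ := Finset.mem_inter.1 hx
    obtain ⟨hy, hy'⟩ := Finset.mem_inter.1 hy
    exact Finset.mem_inter.2 ⟨hB.add_mem h0 h0' h1 hx hy, hB'.add_mem h0 h0' h1 hx' hy'⟩
  doubling ρ h0 h1 := by
    obtain ⟨T, c, hT, hcT, hc⟩ := hB.exists_labelling h0 h1
    obtain ⟨T', c', hT', hcT', hc'⟩ := hB'.exists_labelling h0 h1
    obtain ⟨X, hX, hcov⟩ := exists_translates_cover (BourgainRoth.inter B B' (2 * ρ))
      (BourgainRoth.inter B B' ρ) (T ×ˢ T') (fun x => (c x, c' x))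
      (fun x hx => by
        obtain ⟨hx, hx'⟩ := Finset.mem_inter.1 hx
        exact Finset.mem_product.2 ⟨hcT x hx, hcT' x hx'⟩)
      (fun x hx y hy hxy => by
        obtain ⟨hx, hx'⟩ := Finset.mem_inter.1 hx
        obtain ⟨hy, hy'⟩ := Finset.mem_inter.1 hy
        obtain ⟨e, e'⟩ := Prod.ext_iff.1 hxy
        exact Finset.mem_inter.2 ⟨hc x hx y hy e, hc' x hx' y hy' e'⟩)
    refine ⟨X, ?_, hcov⟩
    calc (X.card : ℝ) ≤ ((T ×ˢ T').card : ℝ) := by exact_mod_cast hX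
      _ = T.card * T'.card := by rw [Finset.card_product, Nat.cast_mul]
      _ ≤ 2 ^ (2 * d) * 2 ^ (2 * d') := by gcongr
      _ = 2 ^ (2 * (d + d')) := by rw [← Real.rpow_add (by norm_num)]; ring_nf

end IsBourgainSystem

variable [Fintype G]

/-- A system has a dilate that is regular with respect to every dimension which is at least `1`
and controls its growth between the scales `1 / 2` and `1`. -/
lemma IsBourgainSystem.exists_regular_growth (hB : IsBourgainSystem B d) {D : ℝ} (hD : 1 ≤ D)
    (hgrowth : ((B 1).card : ℝ) ≤ 2 ^ D * (B (1 / 2)).card) :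
    ∃ l : ℝ, 1 / 2 ≤ l ∧ l ≤ 1 ∧ ∀ η : ℝ, D * |η| ≤ 1 / 2 ^ 3 →
      1 - 2 ^ 3 * D * |η| ≤ haar (BourgainRoth.dilate l B 1) /
          haar (BourgainRoth.dilate l B (1 + η)) ∧
        haar (BourgainRoth.dilate l B 1) / haar (BourgainRoth.dilate l B (1 + η)) ≤
          1 + 2 ^ 3 * D * |η| := by
  obtain ⟨l, hl, hl1, h⟩ := exists_regular_scale (v := fun t => ((B t).card : ℝ)) hD
    (fun s hs t ht hst => Nat.cast_le.2 (Finset.card_le_card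
      (hB.nesting s t (by linarith [hs.1]) hst (by linarith [ht.2]))))
    (fun t ht => hB.card_pos (by linarith [ht.1]) (by linarith [ht.2])) hgrowth
  refine ⟨l, hl, hl1, fun η hη => ?_⟩
  simpa only [haar_div_haar, BourgainRoth.dilate, mul_one] using h η hη

lemma IsBourgainSystem.exists_regular_dilate (hB : IsBourgainSystem B d) {t : ℝ} (h0 : 0 < t)
    (h1 : t ≤ 1) : ∃ l : ℝ, t / 2 ≤ l ∧ l ≤ t ∧ IsRegular (BourgainRoth.dilate l B) d := by
  have hBt := hB.dilate h0 h1
  have hg := hBt.card_two_mul_le (ρ := 1 / 2) (by norm_num) (by norm_num)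
  rw [show (2 : ℝ) * (1 / 2) = 1 by norm_num] at hg
  obtain ⟨l, hl, hl1, h⟩ := hBt.exists_regular_growth hB.one_le_dim hg
  refine ⟨t * l, by nlinarith, by nlinarith, hB.dilate (by nlinarith) (by nlinarith), ?_⟩
  simpa only [BourgainRoth.dilate, mul_assoc] using h

/-- Regularity is arranged for the exponent `D₀` of the actual growth from `B (1/2)` to `B 1`. In
the dilate by `l` that growth is a doubling at radius `1 / (2 l) ≤ 1`, so every admissible dimension
is at least `D₀`; and regularity only weakens as the exponent rises. -/
lemma IsBourgainSystem.exists_universally_regular_dilate (hB : IsBourgainSystem B d) :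
    ∃ l : ℝ, 1 / 2 ≤ l ∧ l ≤ 1 ∧ ∀ D, IsBourgainSystem (BourgainRoth.dilate l B) D →
      IsRegular (BourgainRoth.dilate l B) D := by
  have h1 := hB.card_pos (ρ := 1) (by norm_num) (by norm_num)
  have h2 := hB.card_pos (ρ := 1 / 2) (by norm_num) (by norm_num)
  set D₀ : ℝ := max 1 (Real.logb 2 ((B 1).card / (B (1 / 2)).card)) with hD₀
  have hg : ((B 1).card : ℝ) ≤ 2 ^ D₀ * (B (1 / 2)).card := by
    rw [← div_le_iff₀ h2, ← Real.logb_le_iff_le_rpow (by norm_num) (div_pos h1 h2)]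
    exact le_max_right _ _
  obtain ⟨l, hl, hl1, h⟩ := hB.exists_regular_growth (le_max_left _ _) hg
  refine ⟨l, hl, hl1, fun D hD => ⟨hD, fun η hη => ?_⟩⟩
  have hDD : D₀ ≤ D := by
    refine max_le hD.one_le_dim ?_
    rw [Real.logb_le_iff_le_rpow (by norm_num) (div_pos h1 h2), div_le_iff₀ h2]
    have := hD.card_two_mul_le (ρ := 1 / (2 * l)) (by positivity)
      (by rw [div_le_one (by linarith)]; linarith)
    have hl0 : l ≠ 0 := by linarith
    simp only [BourgainRoth.dilate] at this
    rwa [show l * (2 * (1 / (2 * l))) = 1 by field_simp,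
      show l * (1 / (2 * l)) = 1 / 2 by field_simp] at this
  have hmul : D₀ * |η| ≤ D * |η| := by gcongr
  obtain ⟨ha, hb⟩ := h η (hmul.trans hη)
  constructor <;> linarith

end Systems

/-! ### Bohr sets as Bourgain systems. -/

/-- The square of side `s / 2` containing a complex number. -/
noncomputable def cell (s : ℝ) (z : ℂ) : ℤ × ℤ := (⌊2 * z.re / s⌋, ⌊2 * z.im / s⌋)

lemma norm_sub_le_of_cell_eq {s : ℝ} (hs : 0 < s) {z w : ℂ} (h : cell s z = cell s w) :
    ‖z - w‖ ≤ s := by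
  have aux : ∀ a b : ℝ, ⌊2 * a / s⌋ = ⌊2 * b / s⌋ → |a - b| ≤ s / 2 := by
    intro a b hab
    have := Int.abs_sub_lt_one_of_floor_eq_floor hab
    rw [← sub_div, ← mul_sub, abs_div, abs_mul, abs_two, abs_of_pos hs, div_lt_one hs] at this
    linarith
  obtain ⟨h1, h2⟩ := Prod.ext_iff.1 h
  have h3 := aux _ _ h1
  have h4 := aux _ _ h2
  have := Complex.norm_le_abs_re_add_abs_im (z - w)
  rw [Complex.sub_re, Complex.sub_im] at this
  linarith

lemma cell_mem {s : ℝ} (hs : 0 < s) (N : ℕ) {z : ℂ} (h : ‖z‖ ≤ N * s / 2) :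
    cell s z ∈ Finset.Icc (-(N : ℤ)) N ×ˢ Finset.Icc (-(N : ℤ)) N := by
  have aux : ∀ a : ℝ, |a| ≤ ‖z‖ → ⌊2 * a / s⌋ ∈ Finset.Icc (-(N : ℤ)) N := by
    intro a ha
    obtain ⟨h1, h2⟩ := abs_le.1 (ha.trans h)
    rw [Finset.mem_Icc, Int.le_floor]
    constructor
    · push_cast
      rw [le_div_iff₀ hs]; linarith
    · have : (⌊2 * a / s⌋ : ℝ) ≤ N := (Int.floor_le _).trans (by rw [div_le_iff₀ hs]; linarith)
      exact_mod_cast this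
  exact Finset.mem_product.2 ⟨aux _ (Complex.abs_re_le_norm z), aux _ (Complex.abs_im_le_norm z)⟩

section Bohr
variable {G : Type*} [AddCommGroup G] [Finite G]

lemma norm_addChar_sub_sub_one (γ : AddChar G ℂ) (x y : G) : ‖γ (x - y) - 1‖ = ‖γ x - γ y‖ := by
  have h : γ x - γ y = (γ (x - y) - 1) * γ y := by
    rw [sub_mul, one_mul, ← AddChar.map_add_eq_mul, sub_add_cancel]
  rw [h, norm_mul, AddChar.norm_apply, mul_one]

lemma norm_addChar_add_sub_one_le (γ : AddChar G ℂ) (x y : G) :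
    ‖γ (x + y) - 1‖ ≤ ‖γ x - 1‖ + ‖γ y - 1‖ := by
  have h : γ (x + y) - 1 = (γ x - 1) * γ y + (γ y - 1) := by
    rw [AddChar.map_add_eq_mul]; ring
  rw [h]
  refine (norm_add_le _ _).trans ?_
  rw [norm_mul, AddChar.norm_apply, mul_one]

lemma norm_addChar_neg_sub_one (γ : AddChar G ℂ) (x : G) : ‖γ (-x) - 1‖ = ‖γ x - 1‖ := by
  rw [← zero_sub, norm_addChar_sub_sub_one, AddChar.map_zero_eq_one, norm_sub_rev]

/-- The label of `x` records the cell of `γ x - c` for each `γ ∈ Γ`. -/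
lemma exists_character_labelling (Γ : Finset (AddChar G ℂ)) {s : ℝ} (hs : 0 < s) (N : ℕ) (c : ℂ)
    (S : Finset G) (hS : ∀ x ∈ S, ∀ γ ∈ Γ, ‖γ x - c‖ ≤ N * s / 2) :
    ∃ (T : Finset (Γ → ℤ × ℤ)) (lab : G → Γ → ℤ × ℤ), T.card = ((2 * N + 1) ^ 2) ^ Γ.card ∧
      (∀ x ∈ S, lab x ∈ T) ∧
      ∀ x y, lab x = lab y → ∀ γ ∈ Γ, ‖γ (x - y) - 1‖ ≤ s := by
  classical
  refine ⟨Fintype.piFinset fun _ => Finset.Icc (-(N : ℤ)) N ×ˢ Finset.Icc (-(N : ℤ)) N,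
    fun x γ => cell s (γ.1 x - c), ?_, ?_, ?_⟩
  · rw [Fintype.card_piFinset, Finset.prod_const, Finset.card_univ, Finset.card_product,
      Int.card_Icc, Fintype.card_coe, ← sq]
    congr 2
    omega
  · intro x hx
    exact Fintype.mem_piFinset.2 fun γ => cell_mem hs N (hS x hx γ.1 γ.2)
  · intro x y h γ hγ
    have := norm_sub_le_of_cell_eq hs (congrFun h ⟨γ, hγ⟩)
    rw [norm_addChar_sub_sub_one]
    simpa using this

end Bohr

open Classical in
/-- The system of Bohr sets with frequency set `Γ` and width `r`. -/
noncomputable def bohr {G : Type*} [AddCommGroup G] [Fintype G] (Γ : Finset (AddChar G ℂ)) (r : ℝ) : ℝ → Finset G :=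
  fun ρ => Finset.univ.filter fun x => ∀ γ ∈ Γ, ‖γ x - 1‖ ≤ r * ρ

lemma mem_bohr {G : Type*} [AddCommGroup G] [Fintype G] {Γ : Finset (AddChar G ℂ)} {r ρ : ℝ}
    {x : G} :
    x ∈ bohr Γ r ρ ↔ ∀ γ ∈ Γ, ‖γ x - 1‖ ≤ r * ρ := by
  simp [bohr]

section BohrSystem
variable {G : Type*} [AddCommGroup G] [Fintype G] [DecidableEq G]

/-- Mesh `r ρ` on a disc of radius `2 r ρ` needs `9² ≤ 2⁷` cells per character. The extra `1` keeps
the dimension at least `1` when `Γ` is empty. -/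
lemma isBourgainSystem_bohr (Γ : Finset (AddChar G ℂ)) {r : ℝ} (hr : 0 < r) :
    IsBourgainSystem (bohr Γ r) (7 * Γ.card + 1) where
  one_le_dim := by
    have : (0 : ℝ) ≤ Γ.card := Nat.cast_nonneg _
    linarith
  nesting ρ' ρ h0 h1 h2 x hx := mem_bohr.2 fun γ hγ => (mem_bohr.1 hx γ hγ).trans (by gcongr)
  zero_mem ρ h0 h2 := mem_bohr.2 fun γ hγ => by simp; positivity
  symmetry ρ h0 h2 x hx := mem_bohr.2 fun γ hγ => by
    rw [norm_addChar_neg_sub_one]; exact mem_bohr.1 hx γ hγ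
  addition ρ ρ' h0 h0' h1 z hz := by
    obtain ⟨x, hx, y, hy, rfl⟩ := Finset.mem_add.1 hz
    refine mem_bohr.2 fun γ hγ => (norm_addChar_add_sub_one_le γ x y).trans ?_
    rw [mul_add]
    exact add_le_add (mem_bohr.1 hx γ hγ) (mem_bohr.1 hy γ hγ)
  doubling ρ h0 h1 := by
    obtain ⟨T, lab, hT, hmem, hlab⟩ := exists_character_labelling Γ (mul_pos hr h0) 4 1
      (bohr Γ r (2 * ρ)) (fun x hx γ hγ => (mem_bohr.1 hx γ hγ).trans (by push_cast; linarith))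
    obtain ⟨X, hX, hcov⟩ := exists_translates_cover (bohr Γ r (2 * ρ)) (bohr Γ r ρ) T lab hmem
      (fun x _ y _ h => mem_bohr.2 fun γ hγ => hlab x y h γ hγ)
    refine ⟨X, ?_, hcov⟩
    rw [hT] at hX
    calc (X.card : ℝ) ≤ (((2 * 4 + 1) ^ 2) ^ Γ.card : ℕ) := by exact_mod_cast hX
      _ = (81 : ℝ) ^ Γ.card := by push_cast; norm_num
      _ ≤ (2 ^ 7) ^ Γ.card := by gcongr; norm_num
      _ = (2 : ℝ) ^ (7 * Γ.card : ℝ) := by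
          rw [← pow_mul, ← Real.rpow_natCast]; push_cast; rfl
      _ ≤ _ := Real.rpow_le_rpow_of_exponent_le (by norm_num) (by linarith)

/-- Pigeonhole: equal labels force the difference into the Bohr set. Mesh `1/8` on the unit disc
needs `33² ≤ 2¹¹` cells per character. -/
lemma card_le_card_bohr_inter (Γ : Finset (AddChar G ℂ)) (S V : Finset G)
    (h : ∀ x ∈ S, ∀ y ∈ S, x - y ∈ V) :
    (S.card : ℝ) ≤ 2 ^ (11 * Γ.card : ℝ) * (bohr Γ (1 / 4) (1 / 2) ∩ V).card := by
  obtain ⟨T, lab, hT, hmem, hlab⟩ := exists_character_labelling Γ (s := 1 / 8) (by norm_num) 16 0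
    S (fun x _ γ _ => by rw [sub_zero, AddChar.norm_apply]; norm_num)
  obtain ⟨X, hX, hcov⟩ := exists_translates_cover S (bohr Γ (1 / 4) (1 / 2) ∩ V) T lab hmem
    (fun x hx y hy hxy => Finset.mem_inter.2 ⟨mem_bohr.2 fun γ hγ =>
      (hlab x y hxy γ hγ).trans (by norm_num), h x hx y hy⟩)
  rw [hT] at hX
  have h1 : (X.card : ℝ) ≤ 2 ^ (11 * Γ.card : ℝ) := by
    calc (X.card : ℝ) ≤ (((2 * 16 + 1) ^ 2) ^ Γ.card : ℕ) := by exact_mod_cast hX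
      _ = (1089 : ℝ) ^ Γ.card := by push_cast; norm_num
      _ ≤ (2 ^ 11) ^ Γ.card := by gcongr; norm_num
      _ = (2 : ℝ) ^ (11 * Γ.card : ℝ) := by
          rw [← pow_mul, ← Real.rpow_natCast]; push_cast; rfl
  have h2 : (S.card : ℝ) ≤ X.card * (bohr Γ (1 / 4) (1 / 2) ∩ V).card := by
    exact_mod_cast card_le_of_cover hcov
  exact h2.trans (by gcongr)

end BohrSystem

/-! ### Fourier analysis and Bessel's inequality. -/

section Fourier
variable {G : Type*} [AddCommGroup G] [Fintype G]

/-- The unnormalised Fourier transform. -/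
noncomputable def fourier (f : G → ℝ) (γ : AddChar G ℂ) : ℂ := ∑ x, (f x : ℂ) * γ x

/-- The unnormalised convolution. -/
def convolve (f g : G → ℝ) (t : G) : ℝ := ∑ u, f u * g (t - u)

lemma fourier_convolve (f g : G → ℝ) (γ : AddChar G ℂ) :
    fourier (convolve f g) γ = fourier f γ * fourier g γ := by
  simp only [fourier, convolve, Finset.sum_mul_sum]
  push_cast
  simp only [Finset.sum_mul]
  rw [Finset.sum_comm]
  refine Finset.sum_congr rfl fun u _ => ?_
  rw [← Equiv.sum_comp (Equiv.addLeft u)]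
  refine Finset.sum_congr rfl fun v _ => ?_
  simp only [Equiv.coe_addLeft, add_sub_cancel_left, AddChar.map_add_eq_mul]
  ring

lemma sum_fourier_mul (f : G → ℝ) (t : G) :
    ∑ γ : AddChar G ℂ, fourier f γ * γ (-t) = Fintype.card G * f t := by
  classical
  simp only [fourier, Finset.sum_mul, mul_assoc, ← AddChar.map_add_eq_mul]
  rw [Finset.sum_comm]
  simp only [← Finset.mul_sum, AddChar.sum_apply_eq_ite, add_neg_eq_zero]
  simp [mul_comm]

lemma conj_fourier (f : G → ℝ) (γ : AddChar G ℂ) :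
    (starRingEnd ℂ) (fourier f γ) = fourier (fun x => f (-x)) γ := by
  simp only [fourier, map_sum, map_mul, Complex.conj_ofReal, ← AddChar.map_neg_eq_conj]
  rw [← Equiv.sum_comp (Equiv.neg G)]
  simp

lemma sum_norm_fourier_sq (f : G → ℝ) :
    ∑ γ : AddChar G ℂ, ‖fourier f γ‖ ^ 2 = Fintype.card G * ∑ x, f x ^ 2 := by
  -- Parseval is Fourier inversion at `0` for the autocorrelation of `f`.
  have h := sum_fourier_mul (convolve f fun x => f (-x)) 0
  simp only [fourier_convolve, ← conj_fourier, Complex.mul_conj', neg_zero,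
    AddChar.map_zero_eq_one, mul_one] at h
  have h' : ∑ γ : AddChar G ℂ, ‖fourier f γ‖ ^ 2
      = Fintype.card G * convolve f (fun x => f (-x)) 0 := by exact_mod_cast h
  rw [h', convolve]
  simp [sq]

/-- If `f * f` correlates strongly and negatively with the doubled set `2 ⬝ T`, then a large part of
the energy of `f` lies on characters which are biased on `2 ⬝ T`. -/
lemma energy_on_biased_characters [DecidableEq (AddChar G ℂ)] (f : G → ℝ) (T : Finset G)
    {a M : ℝ} (hf : ∑ x, f x ^ 2 ≤ M * a)
    (hneg : ∑ x ∈ T, convolve f f (2 • x) ≤ -(3 / 4 * a ^ 2 * M * T.card)) (hT : 0 < T.card)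
    (ha : 0 ≤ a) (Sp : Finset (AddChar G ℂ))
    (hSp : ∀ γ, a / 4 * T.card < ‖∑ x ∈ T, γ (2 • x)‖ → γ ∈ Sp) :
    1 / 2 * a ^ 2 * M * Fintype.card G ≤ ∑ γ ∈ Sp, ‖fourier f γ‖ ^ 2 := by
  have hN : (0 : ℝ) < Fintype.card G := Nat.cast_pos.2 Fintype.card_pos
  have hT' : (0 : ℝ) < T.card := Nat.cast_pos.2 hT
  have hnorm : ∀ γ : AddChar G ℂ, ‖∑ x ∈ T, γ (-(2 • x))‖ = ‖∑ x ∈ T, γ (2 • x)‖ := by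
    intro γ
    simp only [AddChar.map_neg_eq_conj, ← map_sum, RCLike.norm_conj]
  have hid : ((Fintype.card G * ∑ x ∈ T, convolve f f (2 • x) : ℝ) : ℂ)
      = ∑ γ : AddChar G ℂ, fourier f γ ^ 2 * ∑ x ∈ T, γ (-(2 • x)) := by
    push_cast
    simp only [Finset.mul_sum]
    rw [Finset.sum_comm]
    refine Finset.sum_congr rfl fun x _ => ?_
    rw [← sum_fourier_mul]
    simp only [fourier_convolve, sq]
  have hle : Fintype.card G * (3 / 4 * a ^ 2 * M * T.card)
      ≤ ∑ γ : AddChar G ℂ, ‖fourier f γ‖ ^ 2 * ‖∑ x ∈ T, γ (2 • x)‖ := by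
    calc Fintype.card G * (3 / 4 * a ^ 2 * M * T.card)
        ≤ -(Fintype.card G * ∑ x ∈ T, convolve f f (2 • x)) := by nlinarith
      _ ≤ ‖((Fintype.card G * ∑ x ∈ T, convolve f f (2 • x) : ℝ) : ℂ)‖ := by
          rw [Complex.norm_real]; exact neg_le_abs _
      _ ≤ _ := by
          rw [hid]
          refine (norm_sum_le _ _).trans (Finset.sum_le_sum fun γ _ => ?_)
          rw [norm_mul, norm_pow, hnorm]
  -- By Parseval the characters outside `Sp` account for at most a `1/4` share, so `3/4 - 1/4 = 1/2`
  -- is left on `Sp`.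
  have hpt : ∀ γ : AddChar G ℂ, ‖fourier f γ‖ ^ 2 * ‖∑ x ∈ T, γ (2 • x)‖ ≤
      (if γ ∈ Sp then ‖fourier f γ‖ ^ 2 * T.card else 0) +
        a / 4 * T.card * ‖fourier f γ‖ ^ 2 := by
    intro γ
    have h0 : 0 ≤ ‖fourier f γ‖ ^ 2 := by positivity
    have hb : ‖∑ x ∈ T, γ (2 • x)‖ ≤ T.card := by
      refine (norm_sum_le _ _).trans ?_
      simp [AddChar.norm_apply]
    split_ifs with h
    · have : 0 ≤ a / 4 * T.card * ‖fourier f γ‖ ^ 2 := by positivity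
      nlinarith
    · have := not_lt.1 (mt (hSp γ) h)
      nlinarith
  have hsum := hle.trans (Finset.sum_le_sum fun γ _ => hpt γ)
  rw [Finset.sum_add_distrib, ← Finset.mul_sum, sum_norm_fourier_sq, ← Finset.sum_filter,
    ← Finset.sum_mul, Finset.filter_mem_eq_inter, Finset.univ_inter] at hsum
  have h1 : a / 4 * T.card * (Fintype.card G * ∑ x, f x ^ 2)
      ≤ a / 4 * T.card * (Fintype.card G * (M * a)) := by gcongr
  refine le_of_mul_le_mul_right ?_ hT'
  nlinarith

end Fourier

/-- Bessel's inequality for almost orthogonal unimodular functions. -/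
lemma card_mul_le_of_almost_orthogonal {G ι : Type*} (Γ : Finset ι) (φ : ι → G → ℂ)
    (T Q : Finset G) (hTQ : T ⊆ Q) {ε τ : ℝ} (hε : 0 ≤ ε) (hτ : 0 ≤ τ) (hφ : ∀ i x, ‖φ i x‖ = 1)
    (hbig : ∀ i ∈ Γ, ε * T.card ≤ ‖∑ x ∈ T, φ i x‖)
    (hort : ∀ i ∈ Γ, ∀ j ∈ Γ, i ≠ j →
      ‖∑ x ∈ Q, φ i x * (starRingEnd ℂ) (φ j x)‖ ≤ τ * Q.card) :
    Γ.card * (ε ^ 2 * T.card) ≤ Q.card * (1 + τ * Γ.card) := by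
  classical
  have hc : ∀ i, ∃ c : ℂ, ‖c‖ = 1 ∧ c * ∑ x ∈ T, φ i x = ‖∑ x ∈ T, φ i x‖ := fun i => by
    obtain ⟨c, hc, h⟩ := RCLike.exists_norm_eq_mul_self (∑ x ∈ T, φ i x)
    exact ⟨c, hc, h.symm⟩
  choose c hc1 hc2 using hc
  -- Duality: the phases `c i` align all the biases on `T`. Cauchy–Schwarz then passes to the `L²`
  -- norm of `F` on `Q`, where almost orthogonality applies.
  set F : G → ℂ := fun x => ∑ i ∈ Γ, c i * φ i x with hF
  have h1 : Γ.card * (ε * T.card) ≤ ∑ x ∈ T, ‖F x‖ := by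
    have e : ((∑ i ∈ Γ, ‖∑ x ∈ T, φ i x‖ : ℝ) : ℂ) = ∑ x ∈ T, F x := by
      push_cast
      simp only [← hc2, hF, Finset.mul_sum]
      exact Finset.sum_comm
    calc (Γ.card : ℝ) * (ε * T.card) = ∑ i ∈ Γ, ε * T.card := by simp
      _ ≤ ∑ i ∈ Γ, ‖∑ x ∈ T, φ i x‖ := Finset.sum_le_sum hbig
      _ ≤ ‖((∑ i ∈ Γ, ‖∑ x ∈ T, φ i x‖ : ℝ) : ℂ)‖ := by
          rw [Complex.norm_real]; exact le_abs_self _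
      _ ≤ ∑ x ∈ T, ‖F x‖ := by rw [e]; exact norm_sum_le _ _
  have h2 : (∑ x ∈ T, ‖F x‖) ^ 2 ≤ T.card * ∑ x ∈ Q, ‖F x‖ ^ 2 :=
    sq_sum_le_card_mul_sum_sq.trans (mul_le_mul_of_nonneg_left
      (Finset.sum_le_sum_of_subset_of_nonneg hTQ fun _ _ _ => by positivity) (Nat.cast_nonneg _))
  have h3 : ∑ x ∈ Q, ‖F x‖ ^ 2 ≤ Γ.card * (Q.card * (1 + τ * Γ.card)) := by
    have e : ((∑ x ∈ Q, ‖F x‖ ^ 2 : ℝ) : ℂ) = ∑ i ∈ Γ, ∑ j ∈ Γ,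
        c i * (starRingEnd ℂ) (c j) * ∑ x ∈ Q, φ i x * (starRingEnd ℂ) (φ j x) := by
      push_cast
      simp only [← Complex.mul_conj', hF, map_sum, map_mul, Finset.sum_mul_sum]
      rw [Finset.sum_comm]
      refine Finset.sum_congr rfl fun i _ => ?_
      rw [Finset.sum_comm]
      refine Finset.sum_congr rfl fun j _ => ?_
      rw [Finset.mul_sum]
      refine Finset.sum_congr rfl fun x _ => ?_
      ring
    have hb : ∀ i ∈ Γ, ∀ j ∈ Γ, ‖c i * (starRingEnd ℂ) (c j) *
        ∑ x ∈ Q, φ i x * (starRingEnd ℂ) (φ j x)‖ ≤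
        (if i = j then (Q.card : ℝ) else 0) + τ * Q.card := by
      intro i hi j hj
      rw [norm_mul, norm_mul, RCLike.norm_conj, hc1, hc1, one_mul, one_mul]
      split_ifs with hij
      · have : ‖∑ x ∈ Q, φ i x * (starRingEnd ℂ) (φ j x)‖ ≤ Q.card := by
          refine (norm_sum_le _ _).trans ?_
          simp [hφ]
        have : 0 ≤ τ * (Q.card : ℝ) := by positivity
        linarith
      · rw [zero_add]; exact hort i hi j hj hij
    calc ∑ x ∈ Q, ‖F x‖ ^ 2 ≤ ‖((∑ x ∈ Q, ‖F x‖ ^ 2 : ℝ) : ℂ)‖ := by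
          rw [Complex.norm_real]; exact le_abs_self _
      _ ≤ ∑ i ∈ Γ, ∑ j ∈ Γ, ((if i = j then (Q.card : ℝ) else 0) + τ * Q.card) := by
          rw [e]
          refine (norm_sum_le _ _).trans (Finset.sum_le_sum fun i hi => ?_)
          exact (norm_sum_le _ _).trans (Finset.sum_le_sum fun j hj => hb i hi j hj)
      _ = Γ.card * (Q.card * (1 + τ * Γ.card)) := by
          simp only [Finset.sum_add_distrib, Finset.sum_ite_eq, Finset.sum_const, nsmul_eq_mul,
            Finset.sum_ite_mem, Finset.inter_self]
          ring
  rcases Nat.eq_zero_or_pos Γ.card with hΓ | hΓ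
  · simp [hΓ]
  rcases Nat.eq_zero_or_pos T.card with hT | hT
  · simp only [hT]; simp; positivity
  have hΓ' : (0 : ℝ) < Γ.card := Nat.cast_pos.2 hΓ
  have hT' : (0 : ℝ) < T.card := Nat.cast_pos.2 hT
  have h4 : (Γ.card * (ε * T.card)) ^ 2 ≤ T.card * (Γ.card * (Q.card * (1 + τ * Γ.card))) := by
    calc (Γ.card * (ε * T.card)) ^ 2 ≤ (∑ x ∈ T, ‖F x‖) ^ 2 := by gcongr
      _ ≤ _ := h2.trans (by gcongr)
  refine le_of_mul_le_mul_left ?_ (mul_pos hT' hΓ')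
  nlinarith

/-! ### Almost invariance under translation, and the `L²` increment. -/

section Shifts
variable {G : Type*} [AddCommGroup G] [DecidableEq G]

/-- The number of elements of `P` that the translation by `y` moves out of `P`. -/
def defect (P : Finset G) (y : G) : ℕ := (P.filter fun u => y + u ∉ P).card

lemma ind_nonneg (A : Finset G) (x : G) : 0 ≤ ind A x := by
  unfold ind; split_ifs <;> norm_num

lemma ind_le_one (A : Finset G) (x : G) : ind A x ≤ 1 := by
  unfold ind; split_ifs <;> norm_num

lemma sum_sub_defect_le (P : Finset G) (y : G) {g : G → ℝ} (h0 : ∀ x, 0 ≤ g x)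
    (h1 : ∀ x, g x ≤ 1) : ∑ u ∈ P, g u - defect P y ≤ ∑ x ∈ P, g (x - y) := by
  have hs := Finset.sum_filter_add_sum_filter_not P (fun u => y + u ∉ P) g
  have hbad : ∑ u ∈ P.filter (fun u => y + u ∉ P), g u ≤ defect P y := by
    refine (Finset.sum_le_sum fun u _ => h1 u).trans ?_
    simp [defect]
  have hgood : ∑ u ∈ P.filter (fun u => ¬ (y + u ∉ P)), g u ≤ ∑ x ∈ P, g (x - y) := by
    have e : ∑ u ∈ P.filter (fun u => ¬ (y + u ∉ P)), g u
        = ∑ x ∈ (P.filter (fun u => ¬ (y + u ∉ P))).image (y + ·), g (x - y) := by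
      rw [Finset.sum_image fun a _ b _ h => add_left_cancel h]
      simp
    rw [e]
    refine Finset.sum_le_sum_of_subset_of_nonneg ?_ fun _ _ _ => h0 _
    intro x hx
    obtain ⟨u, hu, rfl⟩ := Finset.mem_image.1 hx
    exact not_not.1 (Finset.mem_filter.1 hu).2
  linarith

/-- Points moved out of `B 1` by an element of `B s` lie in the shell `B 1 \ B (1 - s)`, which is
thin by regularity at `η = -s`. -/
lemma IsRegular.defect_le [Fintype G] {B : ℝ → Finset G} {d s : ℝ} (hB : IsRegular B d)
    (h0 : 0 < s) (hs : d * s ≤ 1 / 8) {y : G} (hy : y ∈ B s) :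
    (defect (B 1) y : ℝ) ≤ 8 * d * s * (B 1).card := by
  have hsys := hB.isBourgainSystem
  have hd := hsys.one_le_dim
  have hs8 : s ≤ 1 / 8 := by nlinarith
  have hsub : (B 1).filter (fun u => y + u ∉ B 1) ⊆ B 1 \ B (1 - s) := by
    intro u hu
    obtain ⟨hu, hyu⟩ := Finset.mem_filter.1 hu
    refine Finset.mem_sdiff.2 ⟨hu, fun h => hyu ?_⟩
    have := hsys.add_mem h0 (by linarith) (by linarith) hy h
    rwa [add_sub_cancel] at this
  have hinc : B (1 - s) ⊆ B 1 := hsys.nesting _ _ (by linarith) (by linarith) (by norm_num)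
  have h1 : (defect (B 1) y : ℝ) + (B (1 - s)).card ≤ (B 1).card := by
    have := Finset.card_le_card hsub
    have := Finset.card_sdiff_add_card_eq_card hinc
    unfold defect
    exact_mod_cast (by omega)
  have hle : ((B (1 - s)).card : ℝ) ≤ (B 1).card := Nat.cast_le.2 (Finset.card_le_card hinc)
  have hpos := hsys.card_pos (ρ := 1 - s) (by linarith) (by linarith)
  have hreg := (hB.regular (-s) (by rw [abs_neg, abs_of_pos h0]; linarith)).2
  rw [haar_div_haar, abs_neg, abs_of_pos h0, ← sub_eq_add_neg, div_le_iff₀ hpos] at hreg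
  have : 2 ^ 3 * d * s * (B (1 - s)).card ≤ 2 ^ 3 * d * s * ((B 1).card : ℝ) := by gcongr
  linarith

/-- A multiplicative function which is biased on `Q` is close to `1` at translations that almost
preserve `Q`. -/
lemma norm_sub_one_le_of_bias (Q : Finset G) (y : G) {φ : G → ℂ} (hφ : ∀ x, ‖φ x‖ = 1)
    (hmul : ∀ x, φ (y + x) = φ y * φ x) {τ : ℝ} (hbias : τ * Q.card ≤ ‖∑ x ∈ Q, φ x‖) :
    ‖φ y - 1‖ * (τ * Q.card) ≤ 2 * defect Q y := by
  set Q' := Q.image (y + ·) with hQ'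
  have hcard : Q'.card = Q.card := Finset.card_image_of_injective _ (add_right_injective y)
  -- Shifting `Q` by `y` multiplies the sum by `φ y`, so the change lives on the two halves of the
  -- symmetric difference, each of size `defect Q y`.
  have hsum : (φ y - 1) * ∑ x ∈ Q, φ x = ∑ x ∈ Q' \ Q, φ x - ∑ x ∈ Q \ Q', φ x := by
    rw [Finset.sum_sdiff_sub_sum_sdiff, hQ', Finset.sum_image fun a _ b _ h => add_left_cancel h]
    simp only [hmul, ← Finset.mul_sum]
    ring
  have hd1 : (Q' \ Q).card = defect Q y := by
    have : Q' \ Q = (Q.filter fun u => y + u ∉ Q).image (y + ·) := by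
      ext x
      simp only [hQ', Finset.mem_sdiff, Finset.mem_image, Finset.mem_filter]
      constructor
      · rintro ⟨⟨u, hu, rfl⟩, h⟩
        exact ⟨u, ⟨hu, h⟩, rfl⟩
      · rintro ⟨u, ⟨hu, h⟩, rfl⟩
        exact ⟨⟨u, hu, rfl⟩, h⟩
    rw [this, Finset.card_image_of_injective _ (add_right_injective y), defect]
  have hd2 : (Q \ Q').card = defect Q y := by
    rw [← hd1]; exact Finset.card_sdiff_comm hcard.symm
  calc ‖φ y - 1‖ * (τ * Q.card) ≤ ‖φ y - 1‖ * ‖∑ x ∈ Q, φ x‖ := by gcongr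
    _ = ‖∑ x ∈ Q' \ Q, φ x - ∑ x ∈ Q \ Q', φ x‖ := by rw [← norm_mul, hsum]
    _ ≤ ‖∑ x ∈ Q' \ Q, φ x‖ + ‖∑ x ∈ Q \ Q', φ x‖ := norm_sub_le _ _
    _ ≤ (Q' \ Q).card + (Q \ Q').card := by
        gcongr
        · exact (norm_sum_le _ _).trans (by simp [hφ])
        · exact (norm_sum_le _ _).trans (by simp [hφ])
    _ = 2 * defect Q y := by rw [hd1, hd2]; ring

variable [Fintype G]

lemma convolve_comm (f g : G → ℝ) (t : G) : convolve f g t = convolve g f t := by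
  unfold convolve
  rw [← Equiv.sum_comp (Equiv.subLeft t)]
  refine Finset.sum_congr rfl fun u _ => ?_
  simp [mul_comm]

lemma sum_ind (A : Finset G) : ∑ x, ind A x = A.card := by
  simp [ind]

lemma sum_ind_mul (A : Finset G) (g : G → ℝ) : ∑ x, ind A x * g x = ∑ x ∈ A, g x := by
  simp [ind]

lemma card_sub_defect_le_convolve (P : Finset G) (hP : ∀ x ∈ P, -x ∈ P) (t : G) :
    (P.card : ℝ) - defect P (-t) ≤ convolve (ind P) (ind P) t := by
  have h := sum_sub_defect_le P (-t) (ind_nonneg P) (ind_le_one P)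
  have e1 : ∑ u ∈ P, ind P u = P.card := by
    rw [← sum_ind_mul, ← sum_ind]
    exact Finset.sum_congr rfl fun x _ => by simp [ind]
  rw [e1] at h
  refine h.trans ?_
  have e2 : ∀ u, ind P (-u) = ind P u := fun u => by
    have : -u ∈ P ↔ u ∈ P := ⟨fun h => by simpa using hP _ h, hP u⟩
    simp [ind, this]
  have e3 : ∑ x ∈ P, ind P (x - -t) = ∑ x ∈ P, ind P (-x - t) :=
    Finset.sum_congr rfl fun x _ => by rw [← e2]; congr 1; abel
  rw [convolve, sum_ind_mul]
  refine le_of_eq (Finset.sum_bij (fun x _ => -x) (fun x hx => hP x hx) (fun _ _ _ _ h => neg_inj.1 h)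
    (fun x hx => ⟨-x, hP x hx, neg_neg x⟩) fun x _ => ?_)
  congr 1; abel

/-- The deviation of the indicator of `A` from its average `a` on `P`. -/
def balanced (A P : Finset G) (a : ℝ) : G → ℝ := fun x => ind A x - a * ind P x

lemma sum_balanced_sq_le {A P : Finset G} (hAP : A ⊆ P) {a : ℝ} (ha : (A.card : ℝ) = a * P.card) :
    ∑ x, balanced A P a x ^ 2 ≤ P.card * a := by
  have e : ∀ x, balanced A P a x ^ 2 = ind A x - 2 * a * ind A x + a ^ 2 * ind P x := by
    intro x
    unfold balanced ind
    by_cases h : x ∈ A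
    · simp [h, hAP h]; ring
    · by_cases h' : x ∈ P <;> simp [h, h']
  simp only [e, Finset.sum_add_distrib, Finset.sum_sub_distrib, ← Finset.mul_sum, sum_ind, ha]
  have : 0 ≤ a ^ 2 * (P.card : ℝ) := by positivity
  nlinarith

/-- The balanced function has sum zero on `P`, so this convolution is minus its sum over the points
that leave `P`, where it is at most `1`. -/
lemma neg_defect_le_convolve_balanced {A P : Finset G} (hP : ∀ x ∈ P, -x ∈ P) (hAP : A ⊆ P)
    {a : ℝ} (ha0 : 0 ≤ a) (ha : (A.card : ℝ) = a * P.card) (t : G) :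
    -(defect P (-t) : ℝ) ≤ convolve (balanced A P a) (ind P) t := by
  have hsum : ∑ u ∈ P, balanced A P a u = 0 := by
    have e : ∑ u ∈ P, balanced A P a u = ∑ u, balanced A P a u := by
      refine Finset.sum_subset (Finset.subset_univ _) fun x _ hx => ?_
      simp [balanced, ind, hx, mt (@hAP x) hx]
    rw [e]
    simp only [balanced, Finset.sum_sub_distrib, ← Finset.mul_sum, sum_ind, ha, sub_self]
  have hconv : convolve (balanced A P a) (ind P) t
      = ∑ u ∈ P.filter (fun u => ¬ (-t + u ∉ P)), balanced A P a u := by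
    rw [convolve, Finset.sum_filter, ← Finset.sum_subset (Finset.subset_univ P)]
    · refine Finset.sum_congr rfl fun u _ => ?_
      have : t - u ∈ P ↔ -t + u ∈ P :=
        ⟨fun h => by have := hP _ h; rwa [neg_sub, sub_eq_neg_add] at this,
          fun h => by have := hP _ h; rwa [neg_add, neg_neg, ← sub_eq_add_neg] at this⟩
      by_cases h : -t + u ∈ P
      · simp [ind, h, this.2 h]
      · simp [ind, h, mt this.1 h]
    · intro x _ hx
      simp [balanced, ind, hx, mt (@hAP x) hx]
  have hs := Finset.sum_filter_add_sum_filter_not P (fun u => -t + u ∉ P) (balanced A P a)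
  have hbad : ∑ u ∈ P.filter (fun u => -t + u ∉ P), balanced A P a u ≤ defect P (-t) := by
    refine (Finset.sum_le_sum (g := fun _ => (1 : ℝ)) fun u _ => ?_).trans (by simp [defect])
    have := ind_le_one A u
    have : 0 ≤ a * ind P u := mul_nonneg ha0 (ind_nonneg P u)
    unfold balanced; linarith
  rw [hconv]; linarith

lemma convolve_ind_lower_bound {A P : Finset G} (hP : ∀ x ∈ P, -x ∈ P) (hAP : A ⊆ P)
    {a : ℝ} (ha0 : 0 ≤ a) (ha : (A.card : ℝ) = a * P.card) (t : G) :
    a ^ 2 * (P.card - defect P (-t)) - 2 * a * defect P (-t) +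
      convolve (balanced A P a) (balanced A P a) t ≤ convolve (ind A) (ind A) t := by
  have e : convolve (ind A) (ind A) t = convolve (balanced A P a) (balanced A P a) t
      + a * convolve (balanced A P a) (ind P) t + a * convolve (ind P) (balanced A P a) t
      + a ^ 2 * convolve (ind P) (ind P) t := by
    simp only [convolve, Finset.mul_sum, ← Finset.sum_add_distrib]
    refine Finset.sum_congr rfl fun u _ => ?_
    simp only [balanced]; ring
  rw [e, convolve_comm (ind P) (balanced A P a)]
  have h1 := neg_defect_le_convolve_balanced hP hAP ha0 ha t
  have h2 := card_sub_defect_le_convolve P hP t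
  have h3 := mul_le_mul_of_nonneg_left h1 ha0
  have h4 := mul_le_mul_of_nonneg_left h2 (sq_nonneg a)
  linarith

lemma conv_eq_convolve (f : G → ℝ) (C : Finset G) :
    conv f C = convolve f (fun x => ind C x / C.card) := by
  funext x
  rw [convolve_comm, conv, convolve]
  simp only [div_mul_eq_mul_div, ← Finset.sum_div]
  rw [sum_ind_mul]

lemma half_le_norm_fourier {C : Finset G} (hC : C.Nonempty) {γ : AddChar G ℂ}
    (h : ∀ x ∈ C, ‖γ x - 1‖ ≤ 1 / 2) :
    1 / 2 ≤ ‖fourier (fun x => ind C x / C.card) γ‖ := by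
  have hc : (0 : ℝ) < C.card := Nat.cast_pos.2 hC.card_pos
  have hc' : (C.card : ℂ) ≠ 0 := by exact_mod_cast hc.ne'
  have e : fourier (fun x => ind C x / C.card) γ = (∑ x ∈ C, γ x) / C.card := by
    rw [fourier, Finset.sum_div, ← Finset.sum_subset (Finset.subset_univ C)]
    · refine Finset.sum_congr rfl fun x hx => ?_
      simp [ind, hx, inv_mul_eq_div]
    · intro x _ hx
      simp [ind, hx]
  have e2 : (∑ x ∈ C, γ x) / (C.card : ℂ) - 1 = (∑ x ∈ C, (γ x - 1)) / C.card := by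
    rw [Finset.sum_sub_distrib]
    simp [sub_div, hc']
  have h1 : ‖(∑ x ∈ C, γ x) / (C.card : ℂ) - 1‖ ≤ 1 / 2 := by
    rw [e2, norm_div, Complex.norm_natCast, div_le_iff₀ hc]
    refine (norm_sum_le _ _).trans ((Finset.sum_le_sum h).trans ?_)
    simp [mul_comm]
  rw [e]
  have h2 := norm_sub_norm_le (1 : ℂ) (1 - (∑ x ∈ C, γ x) / (C.card : ℂ))
  rw [sub_sub_cancel, norm_one, norm_sub_rev] at h2
  linarith

lemma sum_conv (f : G → ℝ) {C : Finset G} (hC : C.Nonempty) : ∑ x, conv f C x = ∑ x, f x := by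
  have hc : (C.card : ℝ) ≠ 0 := Nat.cast_ne_zero.2 hC.card_pos.ne'
  unfold conv
  rw [← Finset.sum_div, Finset.sum_comm, div_eq_iff hc]
  have : ∀ y ∈ C, ∑ x, f (x - y) = ∑ x, f x := fun y _ => Equiv.sum_comp (Equiv.subRight y) f
  rw [Finset.sum_congr rfl this, Finset.sum_const, nsmul_eq_mul, mul_comm]

lemma conv_nonneg {f : G → ℝ} (hf : ∀ x, 0 ≤ f x) (C : Finset G) (x : G) : 0 ≤ conv f C x :=
  div_nonneg (Finset.sum_nonneg fun _ _ => hf _) (Nat.cast_nonneg _)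

lemma conv_le_one {f : G → ℝ} (hf : ∀ x, f x ≤ 1) (C : Finset G) (x : G) : conv f C x ≤ 1 := by
  unfold conv
  refine div_le_one_of_le₀ ((Finset.sum_le_sum fun y _ => hf _).trans (by simp)) (Nat.cast_nonneg _)

lemma conv_sub_mul (f g : G → ℝ) (a : ℝ) (C : Finset G) (x : G) :
    conv (fun x => f x - a * g x) C x = conv f C x - a * conv g C x := by
  unfold conv
  rw [Finset.sum_sub_distrib, ← Finset.mul_sum]
  ring

/-- The inner product averages, over `y, z ∈ C`, the number of points of `A` that remain in `P`
after a shift by `y - z`. -/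
lemma card_sub_le_sum_conv_mul_conv {A P C : Finset G} (hAP : A ⊆ P) (hC : C.Nonempty) {D : ℝ}
    (hD : ∀ y ∈ C, ∀ z ∈ C, (defect P (y - z) : ℝ) ≤ D) :
    A.card - D ≤ ∑ x, conv (ind A) C x * conv (ind P) C x := by
  have hc : (0 : ℝ) < C.card := Nat.cast_pos.2 hC.card_pos
  have e : ∑ x, conv (ind A) C x * conv (ind P) C x
      = (∑ y ∈ C, ∑ z ∈ C, ∑ x, ind A (x - y) * ind P (x - z)) / C.card ^ 2 := by
    unfold conv
    simp only [div_mul_div_comm, ← Finset.sum_div, Finset.sum_mul_sum, ← sq]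
    congr 1
    exact Finset.sum_comm.trans (Finset.sum_congr rfl fun y _ => Finset.sum_comm)
  have key : ∀ y ∈ C, ∀ z ∈ C, A.card - D ≤ ∑ x, ind A (x - y) * ind P (x - z) := by
    intro y hy z hz
    have e1 : ∑ x, ind A (x - y) * ind P (x - z) = ∑ u ∈ A, ind P (y - z + u) := by
      rw [← Equiv.sum_comp (Equiv.addLeft y), ← sum_ind_mul A]
      refine Finset.sum_congr rfl fun u _ => ?_
      simp only [Equiv.coe_addLeft, add_sub_cancel_left]
      congr 2; abel
    have e2 : (A.card : ℝ) - (A.filter fun u => y - z + u ∉ P).card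
        = ∑ u ∈ A, ind P (y - z + u) := by
      have := Finset.card_filter_add_card_filter_not (s := A) (fun u => y - z + u ∉ P)
      have h3 : (A.card : ℝ) = (A.filter fun u => y - z + u ∉ P).card
          + (A.filter fun u => ¬ (y - z + u ∉ P)).card := by exact_mod_cast this.symm
      rw [h3]
      simp [ind]
    have e3 : ((A.filter fun u => y - z + u ∉ P).card : ℝ) ≤ defect P (y - z) :=
      Nat.cast_le.2 (Finset.card_le_card (Finset.filter_subset_filter _ hAP))
    rw [e1, ← e2]
    linarith [hD y hy z hz]
  rw [e, le_div_iff₀ (by positivity)]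
  refine le_trans (le_of_eq ?_) (Finset.sum_le_sum fun y hy => Finset.sum_le_sum (key y hy))
  simp only [Finset.sum_const, nsmul_eq_mul]
  ring

/-- The `L²` density increment: if smoothing by `C` almost preserves `P` and the deviation of `A`
on `P` keeps a lot of energy when smoothed by `C`, then `A` is dense on some translate of `C`. -/
lemma exists_conv_ge_of_energy {A P C : Finset G} (hAP : A ⊆ P)
    (hC : C.Nonempty) {a D E : ℝ} (ha0 : 0 ≤ a) (ha : (A.card : ℝ) = a * P.card)
    (hD : ∀ y ∈ C, ∀ z ∈ C, (defect P (y - z) : ℝ) ≤ D)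
    (hE : E ≤ ∑ x, conv (balanced A P a) C x ^ 2) :
    ∃ x, E + a ^ 2 * P.card - 2 * a * D ≤ conv (ind A) C x * (a * P.card) := by
  -- Expanding the square, the bounds on the cross term and on the `P` term push the energy `E` into
  -- the square sum of the smoothed indicator of `A`, which is at most its maximum times `|A|`.
  have h1 : ∑ x, conv (balanced A P a) C x ^ 2 = ∑ x, conv (ind A) C x ^ 2
      - 2 * a * ∑ x, conv (ind A) C x * conv (ind P) C x + a ^ 2 * ∑ x, conv (ind P) C x ^ 2 := by
    rw [Finset.mul_sum, Finset.mul_sum, ← Finset.sum_sub_distrib, ← Finset.sum_add_distrib]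
    refine Finset.sum_congr rfl fun x _ => ?_
    rw [show conv (balanced A P a) C x = _ from conv_sub_mul _ _ _ _ _]
    ring
  have h2 := card_sub_le_sum_conv_mul_conv hAP hC hD
  have h3 : ∑ x, conv (ind P) C x ^ 2 ≤ P.card := by
    rw [← sum_ind, ← sum_conv (ind P) hC]
    refine Finset.sum_le_sum fun x _ => ?_
    nlinarith [conv_nonneg (ind_nonneg P) C x, conv_le_one (ind_le_one P) C x]
  obtain ⟨x, -, hx⟩ := Finset.exists_max_image Finset.univ (conv (ind A) C) ⟨0, Finset.mem_univ _⟩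
  refine ⟨x, ?_⟩
  have h4 : ∑ y, conv (ind A) C y ^ 2 ≤ conv (ind A) C x * (a * P.card) := by
    rw [← ha, ← sum_ind, ← sum_conv (ind A) hC, Finset.mul_sum]
    refine Finset.sum_le_sum fun y _ => ?_
    rw [sq]
    exact mul_le_mul_of_nonneg_right (hx y (Finset.mem_univ _)) (conv_nonneg (ind_nonneg A) C y)
  have h5 := mul_le_mul_of_nonneg_left h2 (by linarith : 0 ≤ 2 * a)
  have h6 := mul_le_mul_of_nonneg_left h3 (sq_nonneg a)
  rw [ha] at h5
  linarith

end Shifts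

/-! ### From negative correlation to a structured set. -/

section Increment
variable {G : Type*} [AddCommGroup G] [Fintype G] [DecidableEq G]

/-- A maximal almost orthogonal subfamily of a finite family of functions on `Q`. -/
lemma exists_maximal_almost_orthogonal {ι : Type*} [DecidableEq ι] (Sp : Finset ι) (φ : ι → G → ℂ)
    (hφ : ∀ i x, ‖φ i x‖ = 1) (Q : Finset G) {τ : ℝ} (hτ : τ ≤ 1) :
    ∃ Γ ⊆ Sp,
      (∀ i ∈ Γ, ∀ j ∈ Γ, i ≠ j → ‖∑ x ∈ Q, φ i x * (starRingEnd ℂ) (φ j x)‖ ≤ τ * Q.card) ∧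
      ∀ i ∈ Sp, ∃ j ∈ Γ, τ * Q.card ≤ ‖∑ x ∈ Q, φ i x * (starRingEnd ℂ) (φ j x)‖ := by
  classical
  set F : Finset (Finset ι) := Sp.powerset.filter fun Γ => ∀ i ∈ Γ, ∀ j ∈ Γ, i ≠ j →
    ‖∑ x ∈ Q, φ i x * (starRingEnd ℂ) (φ j x)‖ ≤ τ * Q.card with hF
  obtain ⟨Γ, hΓ, hmax⟩ := Finset.exists_max_image F Finset.card ⟨∅, by simp [hF]⟩
  obtain ⟨hsub, hort⟩ := Finset.mem_filter.1 hΓ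
  rw [Finset.mem_powerset] at hsub
  refine ⟨Γ, hsub, hort, fun i hi => ?_⟩
  -- Otherwise `i` could be adjoined to the maximal `Γ`; it is not already there, since it
  -- correlates fully with itself and `τ ≤ 1`.
  by_contra! hlt
  have hsymm : ∀ j, ‖∑ x ∈ Q, φ j x * (starRingEnd ℂ) (φ i x)‖
      = ‖∑ x ∈ Q, φ i x * (starRingEnd ℂ) (φ j x)‖ := by
    intro j
    rw [← RCLike.norm_conj, map_sum]
    congr 1
    refine Finset.sum_congr rfl fun x _ => ?_
    rw [map_mul, Complex.conj_conj, mul_comm]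
  have hiΓ : i ∉ Γ := by
    intro h
    have h1 := hlt i h
    simp only [Complex.mul_conj', hφ] at h1
    simp at h1
    have : (0 : ℝ) ≤ Q.card := Nat.cast_nonneg _
    nlinarith
  have hins : insert i Γ ∈ F := by
    refine Finset.mem_filter.2 ⟨Finset.mem_powerset.2 (Finset.insert_subset hi hsub), ?_⟩
    intro j hj k hk hjk
    rcases Finset.mem_insert.1 hj with rfl | hj' <;> rcases Finset.mem_insert.1 hk with rfl | hk'
    · exact absurd rfl hjk
    · exact (hlt k hk').le
    · rw [hsymm]; exact (hlt j hj').le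
    · exact hort j hj' k hk' hjk
  have := hmax _ hins
  rw [Finset.card_insert_of_notMem hiΓ] at this
  omega

/-- With `u = x - y` the progression is `u, x, 2x - u`. -/
lemma Lam_eq (f : G → ℝ) :
    Lam f f f = (∑ x, f x * convolve f f (2 • x)) / (Fintype.card G : ℝ) ^ 2 := by
  unfold Lam convolve
  congr 1
  refine Finset.sum_congr rfl fun x _ => ?_
  rw [Finset.mul_sum, ← Equiv.sum_comp (Equiv.subLeft x)]
  refine Finset.sum_congr rfl fun u _ => ?_
  simp only [Equiv.subLeft_apply, sub_sub_cancel]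
  rw [two_smul, add_sub_assoc]
  ring

lemma Lam_translate (f : G → ℝ) (c : G) :
    Lam (fun x => f (c + x)) (fun x => f (c + x)) (fun x => f (c + x)) = Lam f f f := by
  unfold Lam
  congr 1
  rw [← Equiv.sum_comp (Equiv.addLeft c) fun x => ∑ y, f (x - y) * f x * f (x + y)]
  simp [add_sub_assoc, add_assoc]

lemma ind_mono {A A' : Finset G} (h : A' ⊆ A) (x : G) : ind A' x ≤ ind A x := by
  unfold ind
  by_cases hx : x ∈ A'
  · simp [hx, h hx]
  · simp only [hx, if_false]; split_ifs <;> norm_num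

lemma conv_mono {f g : G → ℝ} (h : ∀ x, f x ≤ g x) (C : Finset G) (x : G) :
    conv f C x ≤ conv g C x :=
  div_le_div_of_nonneg_right (Finset.sum_le_sum fun _ _ => h _) (Nat.cast_nonneg _)

lemma sum_convolve_le_Lam {A A' A'' : Finset G} (h' : A' ⊆ A) (h'' : A'' ⊆ A) :
    (∑ x ∈ A'', convolve (ind A') (ind A') (2 • x)) / (Fintype.card G : ℝ) ^ 2 ≤
      Lam (ind A) (ind A) (ind A) := by
  rw [Lam_eq]
  refine div_le_div_of_nonneg_right ?_ (by positivity)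
  rw [← sum_ind_mul]
  refine Finset.sum_le_sum fun x _ => mul_le_mul (ind_mono h'' x) ?_ ?_ (ind_nonneg _ _)
  · exact Finset.sum_le_sum fun u _ =>
      mul_le_mul (ind_mono h' _) (ind_mono h' _) (ind_nonneg _ _) (ind_nonneg _ _)
  · exact Finset.sum_nonneg fun u _ => mul_nonneg (ind_nonneg _ _) (ind_nonneg _ _)

/-- Smoothing by `C` at most halves the coefficients on `Sp`, so a quarter of the energy survives:
this is the gain of `1/8` in density. -/
lemma le_conv_of_biased_characters {A P C : Finset G} (hAP : A ⊆ P) (hA : A.Nonempty)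
    (hC : C.Nonempty) {a δ : ℝ} (ha0 : 0 ≤ a) (ha : (A.card : ℝ) = a * P.card)
    (hD : ∀ y ∈ C, ∀ z ∈ C, (defect P (y - z) : ℝ) ≤ δ * P.card)
    (Sp : Finset (AddChar G ℂ))
    (hSp : 1 / 2 * a ^ 2 * P.card * Fintype.card G ≤ ∑ γ ∈ Sp, ‖fourier (balanced A P a) γ‖ ^ 2)
    (hSpC : ∀ γ ∈ Sp, ∀ z ∈ C, ‖γ z - 1‖ ≤ 1 / 2) :
    ∃ x, 9 / 8 * a - 2 * δ ≤ conv (ind A) C x := by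
  have hN : (0 : ℝ) < Fintype.card G := Nat.cast_pos.2 Fintype.card_pos
  have hP : (0 : ℝ) < P.card := Nat.cast_pos.2 (hA.mono hAP).card_pos
  have ha1 : 0 < a := by
    rcases ha0.lt_or_eq with h | h
    · exact h
    · rw [← h, zero_mul] at ha
      exact absurd ha (Nat.cast_ne_zero.2 hA.card_pos.ne')
  have hE : 1 / 8 * a ^ 2 * P.card ≤ ∑ x, conv (balanced A P a) C x ^ 2 := by
    have h := sum_norm_fourier_sq (conv (balanced A P a) C)
    have h2 : 1 / 4 * ∑ γ ∈ Sp, ‖fourier (balanced A P a) γ‖ ^ 2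
        ≤ ∑ γ, ‖fourier (conv (balanced A P a) C) γ‖ ^ 2 := by
      rw [Finset.mul_sum]
      refine (Finset.sum_le_sum fun γ hγ => ?_).trans
        (Finset.sum_le_sum_of_subset_of_nonneg (Finset.subset_univ Sp) fun _ _ _ => by positivity)
      rw [conv_eq_convolve, fourier_convolve, norm_mul, mul_pow, mul_comm]
      have := half_le_norm_fourier hC (hSpC γ hγ)
      refine mul_le_mul_of_nonneg_left ?_ (by positivity)
      nlinarith
    rw [h] at h2
    refine le_of_mul_le_mul_left ?_ hN
    linarith
  obtain ⟨x, hx⟩ := exists_conv_ge_of_energy hAP hC ha0 ha hD hE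
  refine ⟨x, le_of_mul_le_mul_right ?_ (mul_pos ha1 hP)⟩
  linarith

/-- Either a set which is dense on two nested regular dilates contains many progressions, or its
deviation on the larger one correlates with the doubling of the smaller one. -/
lemma many_progressions_or_correlation {B : ℝ → Finset G} {d l₁ l₂ α a b : ℝ}
    (hB : IsBourgainSystem B d) (h0 : 0 < l₁) (h1 : l₁ ≤ 1) (h0' : 0 < l₂)
    (hα0 : 0 < α) (hα1 : α ≤ 1) (hR : IsRegular (dilate l₁ B) d)
    (hl : l₂ ≤ l₁ * (α / (2 ^ 10 * (1 + d)))) (A : Finset G)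
    (ha : ((A ∩ B l₁).card : ℝ) = a * (B l₁).card) (hb : ((A ∩ B l₂).card : ℝ) = b * (B l₂).card)
    (haα : 0.96 * α ≤ a) (hbα : 0.96 * α ≤ b) :
    (α ^ 3 / 2 ^ 5 * ((B l₁).card * (B l₂).card / (Fintype.card G : ℝ) ^ 2) ≤
      Lam (ind A) (ind A) (ind A)) ∨
    ∑ x ∈ A ∩ B l₂, convolve (balanced (A ∩ B l₁) (B l₁) a) (balanced (A ∩ B l₁) (B l₁) a) (2 • x)
      ≤ -(3 / 4 * a ^ 2 * (B l₁).card * (A ∩ B l₂).card) := by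
  have hd := hB.one_le_dim
  have hq : l₂ / l₁ ≤ α / (2 ^ 10 * (1 + d)) := by rw [div_le_iff₀ h0]; linarith
  have hdq : d * (l₂ / l₁) ≤ α / 2 ^ 10 := by
    calc d * (l₂ / l₁) ≤ (1 + d) * (α / (2 ^ 10 * (1 + d))) := by gcongr; linarith
      _ = α / 2 ^ 10 := by field_simp
  have hq0 : 0 < l₂ / l₁ := div_pos h0' h0
  have hq1 : l₂ / l₁ ≤ 1 / 2 ^ 10 := by nlinarith
  have e1 : l₁ * (l₂ / l₁ + l₂ / l₁) = l₂ + l₂ := by field_simp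
  have hl₂ : l₂ ≤ 1 / 4 := by
    have : l₁ * (l₂ / l₁) = l₂ := by field_simp
    nlinarith
  have hP0 := hB.card_pos h0 (by linarith)
  have hQ0 := hB.card_pos h0' (by linarith)
  rw [or_iff_not_imp_right]
  intro hneg
  push Not at hneg
  have ha0 : 0 < a := by linarith
  have hb0 : 0 < b := by linarith
  have hpt : ∀ x ∈ A ∩ B l₂, 15 / 16 * a ^ 2 * (B l₁).card +
      convolve (balanced (A ∩ B l₁) (B l₁) a) (balanced (A ∩ B l₁) (B l₁) a) (2 • x) ≤
      convolve (ind (A ∩ B l₁)) (ind (A ∩ B l₁)) (2 • x) := by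
    intro x hx
    have hxB := (Finset.mem_inter.1 hx).2
    have hmem : -(2 • x) ∈ dilate l₁ B (l₂ / l₁ + l₂ / l₁) := by
      rw [dilate, e1, two_smul]
      exact hB.symmetry _ (by linarith) (by linarith) _ (hB.add_mem h0' h0' (by linarith) hxB hxB)
    have hdef := hR.defect_le (by positivity) (by linarith) hmem
    rw [dilate, mul_one] at hdef
    -- Here `8 d * (2 l₂ / l₁) ≤ α / 64 ≤ a / 60`, since `a ≥ 0.96 α`. The total loss `a² / 20` is
    -- what `15/16` allows for.
    have hdef' : (defect (B l₁) (-(2 • x)) : ℝ) ≤ a / 60 * (B l₁).card := by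
      refine hdef.trans ?_
      gcongr
      nlinarith
    have hlow := convolve_ind_lower_bound (A := A ∩ B l₁) (P := B l₁)
      (fun x hx => hB.symmetry _ h0 (by linarith) x hx) Finset.inter_subset_right ha0.le ha (2 • x)
    have ha1 : a ≤ 1 := by
      have : ((A ∩ B l₁).card : ℝ) ≤ (B l₁).card :=
        Nat.cast_le.2 (Finset.card_le_card Finset.inter_subset_right)
      rw [ha] at this
      nlinarith
    have h2 : a ^ 2 * (defect (B l₁) (-(2 • x)) : ℝ) ≤ a * (a / 60 * (B l₁).card) := by
      rw [sq, mul_assoc]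
      refine mul_le_mul_of_nonneg_left ?_ ha0.le
      have : (0 : ℝ) ≤ defect (B l₁) (-(2 • x)) := Nat.cast_nonneg _
      nlinarith
    have h3 := mul_le_mul_of_nonneg_left hdef' ha0.le
    have h4 : 0 ≤ a ^ 2 * ((B l₁).card : ℝ) := by positivity
    nlinarith
  have hsum := Finset.sum_le_sum hpt
  rw [Finset.sum_add_distrib, Finset.sum_const, nsmul_eq_mul] at hsum
  refine le_trans ?_ (sum_convolve_le_Lam (A' := A ∩ B l₁) (A'' := A ∩ B l₂)
    Finset.inter_subset_left Finset.inter_subset_left)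
  rw [← mul_div_assoc]
  refine div_le_div_of_nonneg_right ?_ (by positivity)
  have h5 : α ^ 3 / 2 ^ 5 ≤ 3 / 16 * (a ^ 2 * b) := by
    have : (0.96 * α) ^ 2 * (0.96 * α) ≤ a ^ 2 * b := by gcongr
    have : 0 < α ^ 3 := by positivity
    nlinarith
  have h6 : 3 / 16 * a ^ 2 * (B l₁).card * (A ∩ B l₂).card ≤
      ∑ x ∈ A ∩ B l₂, convolve (ind (A ∩ B l₁)) (ind (A ∩ B l₁)) (2 • x) := by linarith
  refine le_trans ?_ h6
  rw [hb]
  calc α ^ 3 / 2 ^ 5 * (((B l₁).card : ℝ) * (B l₂).card)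
      ≤ 3 / 16 * (a ^ 2 * b) * (((B l₁).card : ℝ) * (B l₂).card) := by gcongr
    _ = _ := by ring

/-- Few Bohr constraints and a small dilate of `2 ⬝ B` suffice to make all the biased characters
close to `1`. -/
lemma exists_bohr_set_annihilating {B : ℝ → Finset G} {d l α a b : ℝ}
    (hB : IsBourgainSystem B d) (h0 : 0 < l) (h1 : l ≤ 1) (hα0 : 0 < α) (hα1 : α ≤ 1)
    (hR : IsRegular (dilate l B) d) {T : Finset G} (hT : T ⊆ B l)
    (hb : (T.card : ℝ) = b * (B l).card) (haα : 0.96 * α ≤ a) (hbα : 0.96 * α ≤ b)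
    (Sp : Finset (AddChar G ℂ)) (hSp : ∀ γ ∈ Sp, a / 4 * T.card < ‖∑ x ∈ T, γ (2 • x)‖) :
    ∃ Γ : Finset (AddChar G ℂ), (Γ.card : ℝ) ≤ 26 / α ^ 3 ∧
      ∀ γ ∈ Sp, ∀ y ∈ B (l * (α ^ 3 / (2 ^ 12 * (1 + d)))),
        (∀ γ' ∈ Γ, ‖γ' (2 • y) - 1‖ ≤ 1 / 4) → ‖γ (2 • y) - 1‖ ≤ 1 / 2 := by
  classical
  have hd := hB.one_le_dim
  have hα3 : 0 < α ^ 3 := by positivity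
  have hα3' : α ^ 3 ≤ 1 := pow_le_one₀ hα0.le hα1
  have hQ0 := hB.card_pos h0 (by linarith)
  have ha0 : 0 < a := by linarith
  obtain ⟨Γ, hΓ, hort, hmax⟩ := exists_maximal_almost_orthogonal Sp (fun γ x => γ (2 • x))
    (fun γ x => AddChar.norm_apply _ _) (B l) (τ := α ^ 3 / 64) (by linarith)
  refine ⟨Γ, ?_, ?_⟩
  · have h := card_mul_le_of_almost_orthogonal Γ (fun γ x => γ (2 • x)) T (B l) hT
      (ε := a / 4) (τ := α ^ 3 / 64) (by positivity) (by positivity)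
      (fun γ x => AddChar.norm_apply _ _) (fun γ hγ => (hSp γ (hΓ hγ)).le) hort
    rw [hb] at h
    have h2 : (Γ.card : ℝ) * ((a / 4) ^ 2 * b) ≤ 1 + α ^ 3 / 64 * Γ.card := by
      refine le_of_mul_le_mul_left ?_ hQ0
      linarith
    -- `0.96³ / 16 > 0.055`, and `0.055 - 1/64 > 1/26` gives the bound on `Γ`.
    have h3 : 0.055 * α ^ 3 ≤ (a / 4) ^ 2 * b := by
      have : (0.96 * α / 4) ^ 2 * (0.96 * α) ≤ (a / 4) ^ 2 * b := by gcongr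
      nlinarith
    have h4 : (Γ.card : ℝ) * (0.055 * α ^ 3) ≤ (Γ.card : ℝ) * ((a / 4) ^ 2 * b) := by gcongr
    rw [le_div_iff₀ hα3]
    nlinarith
  · intro γ hγ y hy hΓy
    obtain ⟨γ', hγ', hbias⟩ := hmax γ hγ
    set κ := α ^ 3 / (2 ^ 12 * (1 + d)) with hκ
    have hκ0 : 0 < κ := by positivity
    have hdκ : d * κ ≤ α ^ 3 / 2 ^ 12 := by
      calc d * κ ≤ (1 + d) * κ := by gcongr; linarith
        _ = α ^ 3 / 2 ^ 12 := by rw [hκ]; field_simp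
    have hdef := hR.defect_le hκ0 (by linarith) (y := y) hy
    rw [dilate, mul_one] at hdef
    have hφ := norm_sub_one_le_of_bias (B l) y
      (φ := fun x => γ (2 • x) * (starRingEnd ℂ) (γ' (2 • x)))
      (fun x => by rw [norm_mul, RCLike.norm_conj, AddChar.norm_apply, AddChar.norm_apply, one_mul])
      (fun x => by rw [smul_add, AddChar.map_add_eq_mul, AddChar.map_add_eq_mul, map_mul]; ring)
      hbias
    -- The choice of `κ` gives `16 d κ ≤ α³ / 256`, a quarter of the bias `α³ / 64`.
    have hφ' : ‖γ (2 • y) * (starRingEnd ℂ) (γ' (2 • y)) - 1‖ ≤ 1 / 4 := by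
      refine le_of_mul_le_mul_right ?_ (mul_pos (by positivity : 0 < α ^ 3 / 64) hQ0)
      refine hφ.trans ?_
      nlinarith
    have hu : (starRingEnd ℂ) (γ' (2 • y)) * γ' (2 • y) = 1 := by
      rw [mul_comm, Complex.mul_conj', AddChar.norm_apply]; norm_num
    have e : γ (2 • y) - 1 = (γ (2 • y) * (starRingEnd ℂ) (γ' (2 • y)) - 1) * γ' (2 • y)
        + (γ' (2 • y) - 1) := by
      rw [sub_mul, mul_assoc, hu]; ring
    rw [e]
    refine (norm_add_le _ _).trans ?_
    rw [norm_mul, AddChar.norm_apply, mul_one]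
    linarith [hΓy γ' hγ']

end Increment

/-! ### Two dense scales and the Bohr increment. -/

section Iteration
variable {G : Type*} [AddCommGroup G] [Fintype G] [DecidableEq G]

lemma abs_conv_ind (A C : Finset G) (x : G) : |conv (ind A) C x| = conv (ind A) C x :=
  abs_of_nonneg (conv_nonneg (ind_nonneg A) C x)

lemma conv_le_maxDensity (A : Finset G) (B : ℝ → Finset G) (x : G) :
    conv (ind A) (B 1) x ≤ maxDensity A B := by
  rw [← abs_conv_ind]
  exact le_ciSup (f := fun x => |conv (ind A) (B 1) x|) (Set.finite_range _).bddAbove x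

lemma exists_conv_eq_maxDensity (A : Finset G) (B : ℝ → Finset G) :
    ∃ x, conv (ind A) (B 1) x = maxDensity A B := by
  obtain ⟨x, hx⟩ := exists_eq_ciSup_of_finite (f := fun x => |conv (ind A) (B 1) x|)
  exact ⟨x, by rw [← abs_conv_ind]; exact hx⟩

open Classical in
/-- The translate `A - c`. -/
noncomputable def translate (A : Finset G) (c : G) : Finset G :=
  Finset.univ.filter fun u => c + u ∈ A

lemma mem_translate {A : Finset G} {c u : G} : u ∈ translate A c ↔ c + u ∈ A := by
  simp [translate]

lemma ind_translate (A : Finset G) (c : G) : ind (translate A c) = fun u => ind A (c + u) := by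
  funext u
  simp [ind, mem_translate]

lemma conv_ind_translate (A C : Finset G) (c x : G) :
    conv (ind (translate A c)) C x = conv (ind A) C (c + x) := by
  simp only [conv, ind_translate, add_sub_assoc]

lemma conv_ind_mul_card {A S : Finset G} (hS : ∀ x ∈ S, -x ∈ S) (h0 : S.Nonempty) (c : G) :
    conv (ind A) S c * S.card = ((translate A c ∩ S).card : ℝ) := by
  have hc : (S.card : ℝ) ≠ 0 := Nat.cast_ne_zero.2 h0.card_pos.ne'
  rw [conv, div_mul_cancel₀ _ hc]
  have e : ∑ y ∈ S, ind A (c - y) = ∑ u ∈ S, ind (translate A c) u := by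
    rw [ind_translate]
    exact Finset.sum_bij (fun x _ => -x) (fun x hx => hS x hx) (fun _ _ _ _ h => neg_inj.1 h)
      (fun x hx => ⟨-x, hS x hx, neg_neg x⟩) fun x _ => by rw [sub_eq_add_neg]
  rw [e]
  simp [ind, Finset.inter_comm]

/-- The average over `c + B_1` of the local densities at a smaller scale `s` is almost the density
on `c + B_1`. -/
lemma IsRegular.le_sum_conv {B : ℝ → Finset G} {d s : ℝ} (hB : IsRegular B d) (h0 : 0 < s)
    (hs : d * s ≤ 1 / 8) (A : Finset G) (c : G) :
    (conv (ind A) (B 1) c - 8 * d * s) * (B 1).card ≤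
      ∑ x ∈ B 1, conv (ind A) (B s) (c + x) := by
  have hsys := hB.isBourgainSystem
  have hd := hsys.one_le_dim
  have hs2 : s ≤ 2 := by nlinarith
  have hc := hsys.card_pos h0 hs2
  have hne : (B 1).Nonempty := ⟨0, hsys.zero_mem 1 one_pos (by norm_num)⟩
  have key : ∀ y ∈ B s, (conv (ind A) (B 1) c - 8 * d * s) * (B 1).card ≤
      ∑ x ∈ B 1, ind A (c + x - y) := by
    intro y hy
    have h := sum_sub_defect_le (B 1) y (g := fun u => ind A (c + u)) (fun _ => ind_nonneg _ _)
      (fun _ => ind_le_one _ _)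
    have e : ∑ u ∈ B 1, ind A (c + u) = conv (ind A) (B 1) c * (B 1).card := by
      rw [conv_ind_mul_card (fun x hx => hsys.symmetry 1 one_pos (by norm_num) x hx) hne]
      simp [ind, ← mem_translate, Finset.inter_comm]
    have hdef := hB.defect_le h0 hs hy
    rw [e] at h
    simp only [add_sub_assoc]
    linarith
  unfold conv at key ⊢
  rw [← Finset.sum_div, Finset.sum_comm, le_div_iff₀ hc]
  refine le_trans (le_of_eq ?_) (Finset.sum_le_sum key)
  rw [Finset.sum_const, nsmul_eq_mul, mul_comm]

lemma exists_dense_at_two_scales {B : ℝ → Finset G} {d l₁ l₂ α : ℝ} (hB : IsRegular B d)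
    (h0 : 0 < l₁) (h0' : 0 < l₂) (hle : l₂ ≤ l₁) (hα0 : 0 < α) (hα1 : α ≤ 1)
    (hl : l₁ ≤ α / (2 ^ 9 * (1 + d))) (A : Finset G) {c : G} (hc : conv (ind A) (B 1) c = α)
    (h1 : ∀ x, conv (ind A) (B l₁) x ≤ α * (1 + 1 / 2 ^ 12))
    (h2 : ∀ x, conv (ind A) (B l₂) x ≤ α * (1 + 1 / 2 ^ 12)) :
    ∃ x, 0.96 * α ≤ conv (ind A) (B l₁) x ∧ 0.96 * α ≤ conv (ind A) (B l₂) x := by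
  have hsys := hB.isBourgainSystem
  have hd := hsys.one_le_dim
  have hdl : d * l₁ ≤ α / 2 ^ 9 := by
    calc d * l₁ ≤ (1 + d) * (α / (2 ^ 9 * (1 + d))) := by gcongr; linarith
      _ = α / 2 ^ 9 := by field_simp
  have hdl' : d * l₂ ≤ d * l₁ := by gcongr
  have s1 := hB.le_sum_conv h0 (by linarith) A c
  have s2 := hB.le_sum_conv h0' (by linarith) A c
  have hne : (B 1).Nonempty := ⟨0, hsys.zero_mem 1 one_pos (by norm_num)⟩
  have hpos := hsys.card_pos (ρ := 1) (by norm_num) (by norm_num)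
  -- The sum of the two densities averages to at least `2α - α/32`. Neither exceeds `α (1 + 2⁻¹²)`,
  -- so at the point found each is at least `0.96 α`.
  obtain ⟨x, -, hx⟩ := Finset.exists_le_of_sum_le (s := B 1)
    (f := fun _ => 2 * α - 8 * d * l₁ - 8 * d * l₂)
    (g := fun x => conv (ind A) (B l₁) (c + x) + conv (ind A) (B l₂) (c + x)) hne (by
      rw [Finset.sum_add_distrib, Finset.sum_const, nsmul_eq_mul]
      rw [hc] at s1 s2
      linarith)
  have := h1 (c + x)
  have := h2 (c + x)
  refine ⟨c + x, ?_, ?_⟩ <;> linarith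

/-- Doubling could collapse `B l`, but it is injective on `A`, which fills a proportion `b` of it.
Shrinking by `κ / 4` leaves room for differences before the pigeonhole over `Γ`. -/
lemma IsBourgainSystem.le_card_bohr_inter_double {B : ℝ → Finset G} {d l κ α b : ℝ}
    (hB : IsBourgainSystem B d) (h0 : 0 < l) (h1 : l ≤ 1) (hκ0 : 0 < κ) (hκ1 : κ ≤ 1)
    (A : Finset G) (hA : ∀ x ∈ A, ∀ y ∈ A, 2 • x = 2 • y → x = y)
    (hb : ((A ∩ B l).card : ℝ) = b * (B l).card) (hbα : 0.96 * α ≤ b) (hα0 : 0 ≤ α)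
    (Γ : Finset (AddChar G ℂ)) :
    0.96 * α * (l * κ / 16) ^ d * (B 1).card ≤ 2 ^ (11 * Γ.card : ℝ) *
      (bohr Γ (1 / 4) (1 / 2) ∩ BourgainRoth.double B (l * κ / 2)).card := by
  have hdouble := hB.double
  have hlκ : 0 < l * κ := by positivity
  have hlκ1 : l * κ ≤ 1 := mul_le_one₀ h1 hκ0.le hκ1
  have hb0 : 0 ≤ b := by linarith
  have hd := hB.one_le_dim
  have hdiff : ∀ x ∈ BourgainRoth.double B (l * κ / 4), ∀ y ∈ BourgainRoth.double B (l * κ / 4),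
      x - y ∈ BourgainRoth.double B (l * κ / 2) := by
    intro x hx y hy
    have := hdouble.sub_mem (by positivity) (by positivity) (by linarith) hx hy
    rwa [show l * κ / 4 + l * κ / 4 = l * κ / 2 by ring] at this
  have hsmall := hdouble.card_mul_le h0 h1 (l := κ / 4) (by positivity) (by linarith)
  rw [show κ / 4 * l = l * κ / 4 by ring] at hsmall
  have hinj : b * ((B l).card : ℝ) ≤ (BourgainRoth.double B l).card := by
    rw [← hb, ← Finset.card_image_of_injOn (f := fun x => 2 • x) (s := A ∩ B l)]
    · exact Nat.cast_le.2 (Finset.card_le_card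
        (Finset.image_subset_image Finset.inter_subset_right))
    · intro x hx y hy hxy
      exact hA x (Finset.mem_inter.1 hx).1 y (Finset.mem_inter.1 hy).1 hxy
  have hbig := hB.card_mul_le one_pos le_rfl h0 h1
  rw [mul_one] at hbig
  calc 0.96 * α * (l * κ / 16) ^ d * ((B 1).card : ℝ)
      = 0.96 * α * ((κ / 4 / 2) ^ d * ((l / 2) ^ d * (B 1).card)) := by
        rw [← mul_assoc ((κ / 4 / 2) ^ d), ← Real.mul_rpow (by positivity) (by positivity)]
        ring_nf
    _ ≤ b * ((κ / 4 / 2) ^ d * (B l).card) := by gcongr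
    _ = (κ / 4 / 2) ^ d * (b * (B l).card) := by ring
    _ ≤ (κ / 4 / 2) ^ d * (BourgainRoth.double B l).card := by gcongr
    _ ≤ (BourgainRoth.double B (l * κ / 4)).card := hsmall
    _ ≤ _ := card_le_card_bohr_inter Γ _ _ hdiff

lemma IsRegular.defect_two_smul_sub_le {B : ℝ → Finset G} {d l ν : ℝ} (hR : IsRegular (dilate l B) d)
    (hB : IsBourgainSystem B d) (h0 : 0 < l) (hν0 : 0 < ν) (hν1 : ν ≤ 1 / 4)
    (hν : d * (4 * ν / l) ≤ 1 / 8) {u v : G} (hu : ∃ y ∈ B ν, 2 • y = u)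
    (hv : ∃ y ∈ B ν, 2 • y = v) :
    (defect (B l) (u - v) : ℝ) ≤ 8 * d * (4 * ν / l) * (B l).card := by
  obtain ⟨y, hy, rfl⟩ := hu
  obtain ⟨z, hz, rfl⟩ := hv
  have hyz := hB.sub_mem hν0 hν0 (by linarith) hy hz
  have hmem := hB.add_mem (by positivity) (by positivity) (by linarith) hyz hyz
  have hmem' : 2 • y - 2 • z ∈ dilate l B (4 * ν / l) := by
    rw [dilate, mul_div_cancel₀ _ h0.ne', ← smul_sub, two_smul,
      show 4 * ν = ν + ν + (ν + ν) by ring]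
    exact hmem
  have hdef := hR.defect_le (by positivity) hν hmem'
  rwa [dilate, mul_one] at hdef

/-- Correlation of the deviation of `A` with a doubled set yields a density increment on the
intersection of a Bohr system of small dimension and a dilate of `2 ⬝ B`. -/
lemma exists_bohr_increment {B : ℝ → Finset G} {d l₁ l₂ α a b : ℝ}
    (hB : IsBourgainSystem B d) (h0 : 0 < l₁) (h1 : l₁ ≤ 1) (h0' : 0 < l₂)
    (hα0 : 0 < α) (hα1 : α ≤ 1) (hR : IsRegular (dilate l₁ B) d) (hR' : IsRegular (dilate l₂ B) d)
    (hl : l₂ ≤ l₁ * (α / (2 ^ 10 * (1 + d)))) (A : Finset G)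
    (hA : ∀ x ∈ A, ∀ y ∈ A, 2 • x = 2 • y → x = y)
    (ha : ((A ∩ B l₁).card : ℝ) = a * (B l₁).card) (hb : ((A ∩ B l₂).card : ℝ) = b * (B l₂).card)
    (haα : 0.96 * α ≤ a) (hbα : 0.96 * α ≤ b)
    (hneg : ∑ x ∈ A ∩ B l₂,
      convolve (balanced (A ∩ B l₁) (B l₁) a) (balanced (A ∩ B l₁) (B l₁) a) (2 • x)
        ≤ -(3 / 4 * a ^ 2 * (B l₁).card * (A ∩ B l₂).card)) :
    ∃ (Γ : Finset (AddChar G ℂ)) (m : ℝ) (C : ℝ → Finset G), (Γ.card : ℝ) ≤ 26 / α ^ 3 ∧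
      1 / 2 ≤ m ∧ m ≤ 1 ∧
      C = dilate m (inter (bohr Γ (1 / 4))
        (dilate (l₂ * (α ^ 3 / (2 ^ 12 * (1 + d)))) (double B))) ∧
      IsBourgainSystem C (2 * ((7 * Γ.card + 1) + d)) ∧
      (∀ D, IsBourgainSystem C D → IsRegular C D) ∧
      0.96 * α * (l₂ * (α ^ 3 / (2 ^ 12 * (1 + d))) / 16) ^ d * (B 1).card ≤
        2 ^ (11 * Γ.card : ℝ) * (C 1).card ∧
      ∃ x, α * (1 + 1 / 2 ^ 8) ≤ conv (ind A) (C 1) x := by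
  classical
  have hd := hB.one_le_dim
  have hα3 : 0 < α ^ 3 := by positivity
  have hα3' : α ^ 3 ≤ 1 := pow_le_one₀ hα0.le hα1
  have ha0 : 0 < a := by linarith
  have hb0 : 0 < b := by linarith
  set q := α / (2 ^ 10 * (1 + d)) with hq
  have hq0 : 0 < q := by positivity
  have hdq : d * q ≤ α / 2 ^ 10 := by
    calc d * q ≤ (1 + d) * q := by gcongr; linarith
      _ = α / 2 ^ 10 := by rw [hq]; field_simp
  have hq1 : q ≤ 1 / 2 ^ 10 := by nlinarith
  have hl₂ : l₂ ≤ 1 / 2 ^ 10 := by nlinarith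
  set κ := α ^ 3 / (2 ^ 12 * (1 + d)) with hκ
  have hκ0 : 0 < κ := by positivity
  have hdκ : d * κ ≤ α ^ 3 / 2 ^ 12 := by
    calc d * κ ≤ (1 + d) * κ := by gcongr; linarith
      _ = α ^ 3 / 2 ^ 12 := by rw [hκ]; field_simp
  have hκ1 : κ ≤ 1 / 2 ^ 12 := by nlinarith
  set ν := l₂ * κ with hν
  have hν0 : 0 < ν := by positivity
  have hν1 : ν ≤ 1 / 2 ^ 12 := by nlinarith
  clear_value q κ ν
  have hP0 := hB.card_pos h0 (by linarith)
  have hQ0 := hB.card_pos h0' (by linarith)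
  have hT0 : 0 < (A ∩ B l₂).card := by
    have : (0 : ℝ) < (A ∩ B l₂).card := by rw [hb]; positivity
    exact_mod_cast this
  have hA'0 : (A ∩ B l₁).Nonempty := by
    have : (0 : ℝ) < (A ∩ B l₁).card := by rw [ha]; positivity
    exact Finset.card_pos.1 (by exact_mod_cast this)
  set Sp : Finset (AddChar G ℂ) := Finset.univ.filter fun γ =>
    a / 4 * (A ∩ B l₂).card < ‖∑ x ∈ A ∩ B l₂, γ (2 • x)‖ with hSpdef
  have henergy := energy_on_biased_characters _ (A ∩ B l₂)
    (sum_balanced_sq_le (A := A ∩ B l₁) (P := B l₁) Finset.inter_subset_right ha) hneg hT0 ha0.le Sp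
    (fun γ h => Finset.mem_filter.2 ⟨Finset.mem_univ _, h⟩)
  obtain ⟨Γ, hΓcard, hΓ⟩ := exists_bohr_set_annihilating hB h0' (by linarith) hα0 hα1 hR'
    (T := A ∩ B l₂) Finset.inter_subset_right hb haα hbα Sp
    (fun γ h => (Finset.mem_filter.1 h).2)
  have hdouble := hB.double
  have hC₀ := (isBourgainSystem_bohr Γ (r := 1 / 4) (by norm_num)).inter
    (hdouble.dilate hν0 (by linarith))
  obtain ⟨m, hm, hm1, hreg⟩ := hC₀.exists_universally_regular_dilate
  have hCsys := hC₀.dilate (l := m) (by linarith) hm1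
  set C := dilate m (inter (bohr Γ (1 / 4)) (dilate ν (double B))) with hC
  have hC1 : C 1 = bohr Γ (1 / 4) m ∩ double B (ν * m) := by
    simp only [hC, dilate, inter, mul_one]
  have hCmem : ∀ z ∈ C 1, (∀ γ ∈ Γ, ‖γ z - 1‖ ≤ 1 / 4) ∧ ∃ y ∈ B ν, 2 • y = z := by
    intro z hz
    rw [hC1, Finset.mem_inter] at hz
    refine ⟨fun γ hγ => (mem_bohr.1 hz.1 γ hγ).trans (by linarith), ?_⟩
    obtain ⟨y, hy, rfl⟩ := Finset.mem_image.1 hz.2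
    exact ⟨y, hB.nesting _ _ (by positivity) (by nlinarith) (by linarith) hy, rfl⟩
  have hCne : (C 1).Nonempty := ⟨0, hCsys.zero_mem 1 one_pos (by norm_num)⟩
  refine ⟨Γ, m, C, hΓcard, hm, hm1, rfl, hCsys, hreg, ?_, ?_⟩
  · have hsub : bohr Γ (1 / 4) (1 / 2) ∩ double B (ν / 2) ⊆ C 1 := by
      have := hC₀.nesting (1 / 2) m (by norm_num) hm (by linarith)
      rw [hC1]
      simpa only [inter, dilate, mul_one_div] using this
    have hcard := hB.le_card_bohr_inter_double h0' (by linarith) hκ0 (by linarith) A hA hb hbα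
      hα0.le Γ
    rw [← hν] at hcard
    refine hcard.trans ?_
    gcongr
  · have hD : ∀ y ∈ C 1, ∀ z ∈ C 1,
        (defect (B l₁) (y - z) : ℝ) ≤ α / 2 ^ 12 * (B l₁).card := by
      intro y hy z hz
      have hs : d * (4 * ν / l₁) ≤ α / 2 ^ 20 := by
        have h4 : 4 * ν / l₁ ≤ q * (4 * κ) := by
          rw [div_le_iff₀ h0, hν]
          have : l₂ * κ ≤ l₁ * q * κ := by gcongr
          linarith
        calc d * (4 * ν / l₁) ≤ d * (q * (4 * κ)) := by gcongr
          _ = d * q * (4 * κ) := by ring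
          _ ≤ α / 2 ^ 10 * (4 * (1 / 2 ^ 12)) := by gcongr
          _ = α / 2 ^ 20 := by ring
      refine (hR.defect_two_smul_sub_le hB h0 hν0 (by linarith) (by linarith)
        (hCmem y hy).2 (hCmem z hz).2).trans ?_
      gcongr
      linarith
    obtain ⟨x, hx⟩ := le_conv_of_biased_characters (A := A ∩ B l₁) (P := B l₁)
      Finset.inter_subset_right hA'0 hCne ha0.le ha hD Sp henergy (fun γ hγ z hz => by
        obtain ⟨h, y, hy, rfl⟩ := hCmem z hz
        exact hΓ γ hγ y (by rwa [← hκ, ← hν]) h)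
    -- `9/8 * 0.96 = 1.08` absorbs both the smoothing loss `α / 2¹¹` and the required gain.
    refine ⟨x, le_trans ?_ (hx.trans (conv_mono (ind_mono Finset.inter_subset_left) _ _))⟩
    linarith

lemma eq_of_two_smul_eq {A : Finset G} (hA : ∀ a ∈ A, ∀ b ∈ A, addOrderOf (a - b) ≠ 2) :
    ∀ x ∈ A, ∀ y ∈ A, 2 • x = 2 • y → x = y := by
  intro x hx y hy h
  by_contra hne
  exact hA x hx y hy (addOrderOf_eq_prime (by rw [smul_sub, h, sub_self]) (sub_ne_zero.2 hne))

end Iteration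

/-! ### Density bounds. -/

section Conclusion
variable {G : Type*} [AddCommGroup G] [Fintype G] [DecidableEq G]

lemma density_increment_of_dilate {B : ℝ → Finset G} {d l α : ℝ} (hB : IsBourgainSystem B d)
    (h0 : 0 < l) (h1 : l ≤ 1) (hR : IsRegular (dilate l B) d)
    (hl : α ^ 2 / (2 ^ 24 * (1 + d) ^ 2) ≤ l) (A : Finset G)
    (h : ¬ ∀ x, conv (ind A) (B l) x ≤ α * (1 + 1 / 2 ^ 12)) :
    ∃ l : ℝ, 0 < l ∧ l ≤ 1 ∧ IsRegular (dilate l B) d ∧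
      (α ^ 2 / (2 ^ 25 * (1 + d) ^ 2)) ^ d * density B ≤ density (dilate l B) ∧
      α * (1 + 1 / 2 ^ 12) ≤ maxDensity A (dilate l B) := by
  have hd := hB.one_le_dim
  refine ⟨l, h0, h1, hR, ?_, ?_⟩
  · have := hB.card_mul_le one_pos le_rfl h0 h1
    simp only [density, haar, dilate, ← mul_div_assoc]
    rw [mul_one] at this ⊢
    refine div_le_div_of_nonneg_right (le_trans ?_ this) (Nat.cast_nonneg _)
    refine mul_le_mul_of_nonneg_right (Real.rpow_le_rpow (by positivity) ?_ (by linarith))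
      (Nat.cast_nonneg _)
    calc α ^ 2 / (2 ^ 25 * (1 + d) ^ 2) = α ^ 2 / (2 ^ 24 * (1 + d) ^ 2) / 2 := by
          field_simp
      _ ≤ l / 2 := by gcongr
  · push Not at h
    obtain ⟨x, hx⟩ := h
    have := conv_le_maxDensity A (dilate l B) x
    rw [dilate, mul_one] at this
    exact hx.le.trans this

/-- The base is at most `2⁻¹¹`, so the power absorbs the pigeonhole loss `2 ^ (11 k)` from `k`
characters. -/
lemma le_two_rpow_neg {α d k e : ℝ} (hα0 : 0 < α) (hα1 : α ≤ 1) (hd : 1 ≤ d) (hk : 0 ≤ k)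
    (hke : k ≤ e) :
    (α ^ 3 / (2 ^ 22 * (1 + d))) ^ e * 2 ^ (11 * k) ≤ 1 := by
  have hα3 : α ^ 3 ≤ 1 := pow_le_one₀ hα0.le hα1
  have hbase : α ^ 3 / (2 ^ 22 * (1 + d)) ≤ 1 / 2 ^ 11 := by
    rw [div_le_div_iff₀ (by positivity) (by positivity)]
    nlinarith
  calc (α ^ 3 / (2 ^ 22 * (1 + d))) ^ e * 2 ^ (11 * k)
      ≤ (α ^ 3 / (2 ^ 22 * (1 + d))) ^ k * 2 ^ (11 * k) := by
        gcongr ?_ * _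
        exact Real.rpow_le_rpow_of_exponent_ge (by positivity) (hbase.trans (by norm_num)) hke
    _ ≤ (1 / 2 ^ 11) ^ k * 2 ^ (11 * k) := by gcongr
    _ = 1 := by
        rw [Real.rpow_mul (by norm_num), ← Real.mul_rpow (by norm_num) (by positivity)]
        norm_num

lemma density_inter_bound {α d β S k c : ℝ} (hα0 : 0 < α) (hα1 : α ≤ 1) (hd : 1 ≤ d)
    (hk : 0 ≤ k) (hke : k ≤ 26 / α ^ 3) (hβ : α ^ 5 / (2 ^ 48 * (1 + d) ^ 3) ≤ β) (hS : 0 ≤ S)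
    (h : 0.96 * α * β ^ d * S ≤ 2 ^ (11 * k) * c) :
    α / 2 ^ 2 * (α ^ 3 / (2 ^ 22 * (1 + d))) ^ (2 ^ 13 / α ^ 3) *
      (α ^ 5 / (2 ^ 48 * (1 + d) ^ 3)) ^ d * S ≤ c := by
  have hα3 : 0 < α ^ 3 := by positivity
  have hsmall := le_two_rpow_neg (e := 2 ^ 13 / α ^ 3) hα0 hα1 hd hk
    (hke.trans (by gcongr; norm_num))
  set X := (α ^ 3 / (2 ^ 22 * (1 + d))) ^ (2 ^ 13 / α ^ 3) with hX
  have hX0 : 0 ≤ X := by positivity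
  have hp : (0 : ℝ) < 2 ^ (11 * k) := by positivity
  have hβ0 : 0 ≤ β := le_trans (by positivity) hβ
  have hc : 0 ≤ c := by
    refine nonneg_of_mul_nonneg_right (le_trans ?_ h) hp
    positivity
  calc α / 2 ^ 2 * X * (α ^ 5 / (2 ^ 48 * (1 + d) ^ 3)) ^ d * S
      ≤ 0.96 * α * X * β ^ d * S := by gcongr ?_ * _ * ?_ * _ <;> [linarith; gcongr]
    _ = X * (0.96 * α * β ^ d * S) := by ring
    _ ≤ X * (2 ^ (11 * k) * c) := by gcongr
    _ = (X * 2 ^ (11 * k)) * c := by ring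
    _ ≤ 1 * c := by gcongr
    _ = c := one_mul c

lemma density_sq_bound {B : ℝ → Finset G} {d l₁ l₂ α : ℝ} (hB : IsBourgainSystem B d)
    (h0 : 0 < l₁) (h1 : l₁ ≤ 1) (h0' : 0 < l₂) (h1' : l₂ ≤ 1) (hα0 : 0 < α)
    (hl : α ^ 3 / (2 ^ 42 * (1 + d) ^ 3) ≤ l₁ * l₂) :
    α ^ 3 / 2 ^ 5 * (α ^ 3 / (2 ^ 44 * (1 + d) ^ 3)) ^ d * density B ^ 2 ≤
      α ^ 3 / 2 ^ 5 * ((B l₁).card * (B l₂).card / (Fintype.card G : ℝ) ^ 2) := by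
  have hd := hB.one_le_dim
  have e1 := hB.card_mul_le one_pos le_rfl h0 h1
  have e2 := hB.card_mul_le one_pos le_rfl h0' h1'
  rw [mul_one] at e1 e2
  rw [mul_assoc]
  refine mul_le_mul_of_nonneg_left ?_ (by positivity)
  rw [density, haar, div_pow, ← mul_div_assoc]
  refine div_le_div_of_nonneg_right ?_ (by positivity)
  calc (α ^ 3 / (2 ^ 44 * (1 + d) ^ 3)) ^ d * ((B 1).card : ℝ) ^ 2
      ≤ (l₁ / 2 * (l₂ / 2)) ^ d * ((B 1).card : ℝ) ^ 2 := by
        gcongr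
        calc α ^ 3 / (2 ^ 44 * (1 + d) ^ 3) = α ^ 3 / (2 ^ 42 * (1 + d) ^ 3) / 4 := by
              field_simp; norm_num
          _ ≤ l₁ * l₂ / 4 := by gcongr
          _ = l₁ / 2 * (l₂ / 2) := by ring
    _ = ((l₁ / 2) ^ d * (B 1).card) * ((l₂ / 2) ^ d * (B 1).card) := by
        rw [Real.mul_rpow (by positivity) (by positivity)]; ring
    _ ≤ _ := by gcongr

end Conclusion
end BourgainRoth

/-! ### Assembly of the iteration lemma. -/

open BourgainRoth

theorem lemma5p2 {G : Type*} [AddCommGroup G] [Fintype G] [DecidableEq G]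
    (B : ℝ → Finset G) (d : ℝ) (hB : BourgainRoth.IsRegular B d)
    (A : Finset G) (α : ℝ) (hα : α = BourgainRoth.maxDensity A B) (hpos : 0 < α)
    (hA : ∀ a ∈ A, ∀ b ∈ A, addOrderOf (a - b) ≠ 2) :
    -- lots of three-term progressions
    (α ^ 3 / 2 ^ 5 * (α ^ 3 / (2 ^ 44 * (1 + d) ^ 3)) ^ d * BourgainRoth.density B ^ 2 ≤
      BourgainRoth.Lam (BourgainRoth.ind A) (BourgainRoth.ind A) (BourgainRoth.ind A)) ∨
    -- density increment I
    (∃ l : ℝ, 0 < l ∧ l ≤ 1 ∧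
      BourgainRoth.IsRegular (BourgainRoth.dilate l B) d ∧
      (α ^ 2 / (2 ^ 25 * (1 + d) ^ 2)) ^ d * BourgainRoth.density B ≤
        BourgainRoth.density (BourgainRoth.dilate l B) ∧
      α * (1 + 1 / 2 ^ 12) ≤ BourgainRoth.maxDensity A (BourgainRoth.dilate l B)) ∨
    -- density increment II
    (∃ l : ℝ, 0 < l ∧ l ≤ 1 ∧
      BourgainRoth.IsRegular (BourgainRoth.dilate l (BourgainRoth.double B)) d ∧
      α / 2 ^ 2 * (α ^ 3 / (2 ^ 36 * (1 + d) ^ 3)) ^ d * BourgainRoth.density B ≤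
        BourgainRoth.density (BourgainRoth.dilate l (BourgainRoth.double B)) ∧
      α * (1 + 1 / 2 ^ 8) ≤
        BourgainRoth.maxDensity A (BourgainRoth.dilate l (BourgainRoth.double B))) ∨
    -- density increment III
    (∃ (B' : ℝ → Finset G) (d' : ℝ) (l : ℝ) (C : ℝ → Finset G),
      BourgainRoth.IsBourgainSystem B' d' ∧ d' ≤ 2 ^ 13 / α ^ 3 ∧
      0 < l ∧ l ≤ 1 ∧
      C = BourgainRoth.inter B' (BourgainRoth.dilate l (BourgainRoth.double B)) ∧
      BourgainRoth.IsBourgainSystem C (2 * (d' + d)) ∧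
      (∀ D : ℝ, BourgainRoth.IsBourgainSystem C D → BourgainRoth.IsRegular C D) ∧
      α / 2 ^ 2 * (α ^ 3 / (2 ^ 22 * (1 + d))) ^ (2 ^ 13 / α ^ 3) *
          (α ^ 5 / (2 ^ 48 * (1 + d) ^ 3)) ^ d * BourgainRoth.density B ≤
        BourgainRoth.density C ∧
      α * (1 + 1 / 2 ^ 8) ≤ BourgainRoth.maxDensity A C) := by
  have hsys := hB.isBourgainSystem
  have hd := hsys.one_le_dim
  obtain ⟨c, hc⟩ := exists_conv_eq_maxDensity A B
  rw [← hα] at hc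
  have hα1 : α ≤ 1 := hc ▸ conv_le_one (ind_le_one A) _ _
  set e := 1 + d with he
  have he2 : 2 ≤ e := by linarith
  have hq1 : ∀ n : ℕ, 9 ≤ n → α / (2 ^ n * e) ≤ 1 := by
    intro n _
    rw [div_le_one (by positivity)]
    have : (1 : ℝ) ≤ 2 ^ n := one_le_pow₀ (by norm_num)
    nlinarith
  -- `l₁` is small enough that `B 1` is almost invariant under `B l₁`; `l₂` below plays the same
  -- role for `B l₁` and doubled elements of `B l₂`.
  obtain ⟨l₁, hl₁, hl₁', hR₁⟩ := hsys.exists_regular_dilate (t := α / (2 ^ 9 * e)) (by positivity)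
    (hq1 9 le_rfl)
  have h0 : 0 < l₁ := lt_of_lt_of_le (by positivity) hl₁
  have h1 : l₁ ≤ 1 := hl₁'.trans (hq1 9 le_rfl)
  obtain ⟨l₂, hl₂, hl₂', hR₂⟩ := hsys.exists_regular_dilate (t := l₁ * (α / (2 ^ 10 * e)))
    (by positivity) (mul_le_one₀ h1 (by positivity) (hq1 10 (by norm_num)))
  have h0' : 0 < l₂ := lt_of_lt_of_le (by positivity) hl₂
  have hle : l₂ ≤ l₁ := hl₂'.trans (mul_le_of_le_one_right h0.le (hq1 10 (by norm_num)))
  have hlow₁ : α / (2 ^ 10 * e) ≤ l₁ := le_trans (le_of_eq (by field_simp)) hl₁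
  have hlow₂ : l₁ * (α / (2 ^ 11 * e)) ≤ l₂ := le_trans (le_of_eq (by field_simp)) hl₂
  have hlow₂' : α ^ 2 / (2 ^ 21 * e ^ 2) ≤ l₂ := by
    refine le_trans ?_ hlow₂
    calc α ^ 2 / (2 ^ 21 * e ^ 2) = α / (2 ^ 10 * e) * (α / (2 ^ 11 * e)) := by
          field_simp
      _ ≤ _ := by gcongr
  have hlow : α ^ 2 / (2 ^ 24 * e ^ 2) ≤ l₂ := le_trans (by gcongr <;> norm_num) hlow₂'
  by_cases hI₁ : ∀ x, conv (ind A) (B l₁) x ≤ α * (1 + 1 / 2 ^ 12)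
  swap
  · exact Or.inr (Or.inl (density_increment_of_dilate hsys h0 h1 hR₁ (hlow.trans hle) A hI₁))
  by_cases hI₂ : ∀ x, conv (ind A) (B l₂) x ≤ α * (1 + 1 / 2 ^ 12)
  swap
  · exact Or.inr (Or.inl (density_increment_of_dilate hsys h0' (hle.trans h1) hR₂ hlow A hI₂))
  obtain ⟨x, hx₁, hx₂⟩ := exists_dense_at_two_scales hB h0 h0' hle hpos hα1 hl₁' A hc hI₁ hI₂
  have hcard : ∀ l, 0 < l → l ≤ 1 → ((translate A x ∩ B l).card : ℝ)
      = conv (ind A) (B l) x * (B l).card := fun l hl hl' =>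
    (conv_ind_mul_card (fun y hy => hsys.symmetry l hl (by linarith) y hy)
      ⟨0, hsys.zero_mem l hl (by linarith)⟩ x).symm
  rcases many_progressions_or_correlation hsys h0 h1 h0' hpos hα1 hR₁ hl₂' (translate A x)
    (hcard l₁ h0 h1) (hcard l₂ h0' (hle.trans h1)) hx₁ hx₂ with hprog | hneg
  · left
    rw [ind_translate, Lam_translate] at hprog
    refine (density_sq_bound hsys h0 h1 h0' (hle.trans h1) hpos ?_).trans hprog
    calc α ^ 3 / (2 ^ 42 * e ^ 3) ≤ α ^ 3 / (2 ^ 31 * e ^ 3) := by gcongr <;> norm_num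
      _ = α / (2 ^ 10 * e) * (α ^ 2 / (2 ^ 21 * e ^ 2)) := by field_simp
      _ ≤ l₁ * l₂ := by gcongr
  · have hinj : ∀ y ∈ translate A x, ∀ z ∈ translate A x, 2 • y = 2 • z → y = z := by
      intro y hy z hz hyz
      refine add_left_cancel (eq_of_two_smul_eq hA _ (mem_translate.1 hy) _ (mem_translate.1 hz) ?_)
      rw [smul_add, smul_add, hyz]
    obtain ⟨Γ, m, C, hΓ, hm, hm1, rfl, hCsys, hCreg, hCcard, z, hz⟩ :=
      exists_bohr_increment hsys h0 h1 h0' hpos hα1 hR₁ hR₂ hl₂' (translate A x) hinj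
        (hcard l₁ h0 h1) (hcard l₂ h0' (hle.trans h1)) hx₁ hx₂ hneg
    have hα3 : 0 < α ^ 3 := by positivity
    have hα3' : α ^ 3 ≤ 1 := pow_le_one₀ hpos.le hα1
    have hκ1 : α ^ 3 / (2 ^ 12 * e) ≤ 1 := by
      rw [div_le_one (by positivity)]
      nlinarith
    -- The dilation by `m` distributes over the intersection, and the Bohr dimension is at most `(7
    -- * 26 + 1) / α³ = 183 / α³`.
    refine Or.inr (Or.inr (Or.inr ⟨dilate m (bohr Γ (1 / 4)), 7 * Γ.card + 1,
      l₂ * (α ^ 3 / (2 ^ 12 * e)) * m, _,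
      (isBourgainSystem_bohr Γ (by norm_num)).dilate (by linarith) hm1, ?_, by positivity, ?_, ?_,
      hCsys, hCreg, ?_, ?_⟩))
    · have h26 : 7 * (Γ.card : ℝ) + 1 ≤ 7 * (26 / α ^ 3) + 1 / α ^ 3 := by
        gcongr
        rwa [le_div_iff₀ hα3, one_mul]
      refine h26.trans ?_
      rw [← mul_div_assoc, ← add_div]
      gcongr
      norm_num
    · exact mul_le_one₀ (mul_le_one₀ (hle.trans h1) (by positivity) hκ1) (by linarith) hm1
    · funext ρ
      simp only [dilate, inter, mul_assoc, he]
    · have hN : (0 : ℝ) < Fintype.card G := Nat.cast_pos.2 Fintype.card_pos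
      rw [density, density, haar, haar, ← mul_div_assoc]
      refine div_le_div_of_nonneg_right ?_ hN.le
      refine density_inter_bound hpos hα1 hd (Nat.cast_nonneg _) hΓ ?_ (Nat.cast_nonneg _) hCcard
      calc α ^ 5 / (2 ^ 48 * e ^ 3) ≤ α ^ 5 / (2 ^ 37 * e ^ 3) := by gcongr <;> norm_num
        _ = α ^ 2 / (2 ^ 21 * e ^ 2) * (α ^ 3 / (2 ^ 12 * e)) / 16 := by field_simp; norm_num
        _ ≤ _ := by gcongr
    · rw [conv_ind_translate] at hz
      exact hz.trans (conv_le_maxDensity A _ _)
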